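/- Let $\Pi_1,\dots,\Pi_T$ be probability distributions on $\mathbb R^d$ with strictly positive $C^1$ densities $\pi_1,\dots,\pi_T$, and suppose that $\Pi_t=\Pi$ for all $t\in[T]$, where $\Pi$ has strictly positive $C^1$ density $\pi$. Let $k:\mathbb R^d\times\mathbb R^d\to\mathbb R$ be a symmetric positive semi-definite kernel of class $C^{1,1}$ (the derivatives $\partial_x^\alpha\partial_y^\alpha k$ with $|\alpha|\le 1$ exist and are continuous), let $$k_0(x,y)=\nabla_x\cdot\nabla_y k(x,y)+\nabla_x\log\pi(x)\cdot\nabla_y k(x,y)+\nabla_y\log\pi(y)\cdot\nabla_x k(x,y)+\big(\nabla_x\log\pi(x)\cdot\nabla_y\log\pi(y)\big)k(x,y)$$ be its Langevin Stein kernel, and, for $B\in\mathbb R^{T\times T}$, let $K_0^B$ be the matrix-valued Stein kernel built from $K=Bk$, i.e. with $l_{tr}=\partial^r\log\pi_t$ and $K_{tt'}=B_{tt'}k$, $$(K_0^B(x,y))_{tt'}=\sum_{r=1}^d \partial_x^r\partial_y^rK_{tt'}(x,y)+l_{t'r}(y)\,\partial_x^rK_{tt'}(x,y)+l_{tr}(x)\,\partial_y^rK_{tt'}(x,y)+l_{tr}(x)l_{t'r}(y)K_{tt'}(x,y).$$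 Let $m_1,\dots,m_T\ge1$, let $x_{tj}\in\mathbb R^d$ ($t\in[T]$, $j\in[m_t]$) be data points, let $f_1,\dots,f_T:\mathbb R^d\to\mathbb R$, and let $\theta=(\theta_{tj})$ with $\theta_{tj}\in\mathbb R^T$, regarded as a matrix with rows $\theta_{tj}^\top$. For $B\in\mathbb R^{T\times T}$ put $$g_{\theta,B}(x)=\sum_{t,j}K_0^B(x,x_{tj})\theta_{tj},\qquad J(\theta,\beta,B)=\sum_{t=1}^T\frac1{m_t}\sum_{j=1}^{m_t}\big(f_t(x_{tj})-(g_{\theta,B}(x_{tj}))_t-\beta_t\big)^2 ,$$ and, with $\|\cdot\|_F$ the Frobenius norm, $\mathcal H_{K_0^B}$ the reproducing kernel Hilbert space of $K_0^B$ (for positive semi-definite $B$) and $\dagger$ the Moore–Penrose pseudo-inverse, $$L(\theta,\beta,B)=J(\theta,\beta,B)+\lambda\|g_{\theta,B}\|_{\mathcal H_{K_0^B}}^2+\|B\|_F^2,$$ $$L_\delta(\theta,\beta,B)=J(\theta,\beta,I_T)+\lambda\sum_{t,t'=1}^T\sum_{j=1}^{m_t}\sum_{j'=1}^{m_{t'}}\mathrm{Tr}\big[B^\dagger\big(k_0(x_{tj},x_{t'j'})\theta_{tj}\theta_{t'j'}^\top+\delta^2I_T\big)\big]+\|B\|_F^2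 .$$ Let $G=(k_0(x_{tj},x_{t'j'}))_{(t,j),(t',j')}$ be the Gram matrix of the data points. Then: 1. $K_0^B(x,y)=B\,k_0(x,y)$ for all $B,x,y$. 2. For all $\lambda\ge0$ and $\delta>0$, $L_\delta$ is jointly convex in $(\theta,\beta,B)$, where $B$ ranges over the symmetric strictly positive definite matrices. 3. Let $\lambda>0$ and fix $\beta\in\mathbb R^T$. For every $\delta>0$ the map $(\theta,B)\mapsto L_\delta(\theta,\beta,B)$, with $B$ symmetric strictly positive definite, has a minimiser; any two minimisers have the same $B$ and the same $G\theta$ (so the minimiser is unique if $G$ is invertible); and there is exactly one minimiser whose $\theta$ has least Frobenius norm among the minimisers. 4. Let $\lambda>0$ and fix $\beta\in\mathbb R^T$. There are a $\theta_*$ and a symmetric positive semi-definite $B_*$ such that for every sequence $\delta_\ell>0$ with $\delta_\ell\to0$ and all minimisers $(\theta_\ell,B_\ell)$ of $L_{\delta_\ell}(\cdot,\beta,\cdot)$: $B_\ell\to B_*$ and $G\theta_\ell\to G\theta_*$; and $(\theta_\ell,B_\ell)\to(\theta_*,B_*)$ whenever $G$ is positive definite or the $(\theta_\ell,B_\ell)$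 are the minimisers of least norm. Moreover $(\theta_*B_*^\dagger,B_*)$ minimises $L(\theta,\beta,B)$ over all $\theta$ and all symmetric positive semi-definite $B$, and so does $(\theta'B_*^\dagger,B_*)$ for every $\theta'$ with $G\theta'=G\theta_*$ (in particular for every limit $\theta'$ of minimisers). -/

import Mathlib

open Filter Topology MeasureTheory
open scoped Matrix

noncomputable section

namespace VVCV

/-! ### Targets, kernels and their partial derivatives -/

/-- The sample space `ℝ^d`. -/
abbrev E (d : ℕ) := EuclideanSpace ℝ (Fin d)

/-- `μ` is a probability measure on `ℝ^d` with a strictly positive `C¹` Lebesgue density `p`. -/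
structure IsTarget {d : ℕ} (μ : Measure (E d)) (p : E d → ℝ) : Prop where
  isProbability : IsProbabilityMeasure μ
  contDiff : ContDiff ℝ 1 p
  pos : ∀ x, 0 < p x
  density : μ = volume.withDensity (fun x => ENNReal.ofReal (p x))

/-- The score `∂^r log p (x)`. -/
def score {d : ℕ} (p : E d → ℝ) (x : E d) (r : Fin d) : ℝ :=
  lineDeriv ℝ (fun z => Real.log (p z)) x (EuclideanSpace.single r 1)

/-- The partial derivative `∂_x^r k(x, y)` in the first argument. -/
def pdX {d : ℕ} (r : Fin d) (k : E d → E d → ℝ) (x y : E d) : ℝ :=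
  lineDeriv ℝ (fun z => k z y) x (EuclideanSpace.single r 1)

/-- The partial derivative `∂_y^r k(x, y)` in the second argument. -/
def pdY {d : ℕ} (r : Fin d) (k : E d → E d → ℝ) (x y : E d) : ℝ :=
  lineDeriv ℝ (fun z => k x z) y (EuclideanSpace.single r 1)

/-- A scalar-valued kernel: a symmetric, positive semi-definite function on `ℝ^d × ℝ^d`. -/
structure IsKernel {d : ℕ} (k : E d → E d → ℝ) : Prop where
  symm : ∀ x y, k x y = k y x
  nonneg : ∀ (n : ℕ) (c : Fin n → ℝ) (x : Fin n → E d),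
    0 ≤ ∑ i, ∑ j, c i * c j * k (x i) (x j)

/-- `k ∈ C^{1,1}(ℝ^d × ℝ^d)`: the derivatives `∂_x^α ∂_y^α k` exist and are continuous on
`ℝ^d × ℝ^d` for every multi-index `α` of total degree at most `1`. -/
structure IsC11 {d : ℕ} (k : E d → E d → ℝ) : Prop where
  continuous : Continuous (fun z : E d × E d => k z.1 z.2)
  diffY : ∀ (r : Fin d) (x y : E d),
    LineDifferentiableAt ℝ (fun z => k x z) y (EuclideanSpace.single r 1)
  diffXY : ∀ (r : Fin d) (x y : E d),
    LineDifferentiableAt ℝ (fun z => pdY r k z y) x (EuclideanSpace.single r 1)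
  continuous_pd : ∀ r : Fin d, Continuous (fun z : E d × E d => pdX r (pdY r k) z.1 z.2)

/-- The scalar Langevin Stein kernel `k₀` of the target density `p` and the base kernel `k`. -/
def steinKernel {d : ℕ} (p : E d → ℝ) (k : E d → E d → ℝ) (x y : E d) : ℝ :=
  ∑ r, pdX r (pdY r k) x y + ∑ r, score p x r * pdY r k x y
    + ∑ r, score p y r * pdX r k x y + (∑ r, score p x r * score p y r) * k x y

/-- The matrix-valued Langevin Stein kernel `K₀` of the target densities `π₁, …, π_T` and the
matrix-valued base kernel `K`. -/
def mvSteinKernel {d T : ℕ} (π : Fin T → E d → ℝ)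
    (K : E d → E d → Matrix (Fin T) (Fin T) ℝ) (x y : E d) : Matrix (Fin T) (Fin T) ℝ :=
  Matrix.of fun t t' => ∑ r,
    (pdX r (pdY r (fun x y => K x y t t')) x y
      + score (π t') y r * pdX r (fun x y => K x y t t') x y
      + score (π t) x r * pdY r (fun x y => K x y t t') x y
      + score (π t) x r * score (π t') y r * K x y t t')

/-- The separable kernel `K(x, y) = B k(x, y)`. -/
def sepKernel {d T : ℕ} (B : Matrix (Fin T) (Fin T) ℝ) (k : E d → E d → ℝ)
    (x y : E d) : Matrix (Fin T) (Fin T) ℝ :=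
  k x y • B

/-! ### The norm of a vector-valued reproducing kernel Hilbert space -/

/-- A matrix-valued kernel, read as an operator-valued kernel on the Euclidean space `ℝ^T`. -/
def opKernel {d T : ℕ} (K : E d → E d → Matrix (Fin T) (Fin T) ℝ) :
    Matrix (E d) (E d) (EuclideanSpace ℝ (Fin T) →L[ℝ] EuclideanSpace ℝ (Fin T)) :=
  Matrix.of fun x y => Matrix.toEuclideanCLM (𝕜 := ℝ) (K x y)

open Classical in
/-- The norm `‖g‖_{H_K}` of a function `g : ℝ^d → ℝ^T` in the vector-valued reproducing kernel
Hilbert space `H_K` with the positive semi-definite matrix-valued kernel `K`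
(by convention `0` if `K` is not positive semi-definite or `g` is not in `H_K`). -/
def rkhsNorm {d T : ℕ} (K : E d → E d → Matrix (Fin T) (Fin T) ℝ)
    (g : E d → Fin T → ℝ) : ℝ :=
  if hK : (opKernel K).PosSemidef then
    haveI : Fact (opKernel K).PosSemidef := ⟨hK⟩
    if hg : ∃ u : RKHS.OfKernel (opKernel K), ∀ x, u x = WithLp.toLp 2 (g x) then
      ‖hg.choose‖
    else 0
  else 0

/-! ### Moore–Penrose pseudo-inverse, Frobenius norm -/

/-- The four Penrose equations: `X` is the pseudo-inverse of the real matrix `A`. -/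
structure IsPseudoInverse {ι : Type*} [Fintype ι] (A X : Matrix ι ι ℝ) : Prop where
  mul_mul_left : A * X * A = A
  mul_mul_right : X * A * X = X
  symm_left : (A * X)ᵀ = A * X
  symm_right : (X * A)ᵀ = X * A

theorem IsPseudoInverse.unique {ι : Type*} [Fintype ι] {A X Y : Matrix ι ι ℝ}
    (hX : IsPseudoInverse A X) (hY : IsPseudoInverse A Y) : X = Y := by
  have h1 : A * X = A * Y := by
    calc A * X = (A * X)ᵀ := hX.symm_left.symm
      _ = ((A * Y) * (A * X))ᵀ := by
          rw [← Matrix.mul_assoc, hY.mul_mul_left]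
      _ = (A * X) * (A * Y) := by rw [Matrix.transpose_mul, hX.symm_left, hY.symm_left]
      _ = A * Y := by rw [← Matrix.mul_assoc, hX.mul_mul_left]
  have h2 : X * A = Y * A := by
    calc X * A = (X * A)ᵀ := hX.symm_right.symm
      _ = ((X * A) * (Y * A))ᵀ := by
          rw [Matrix.mul_assoc, ← Matrix.mul_assoc A, hY.mul_mul_left]
      _ = (Y * A) * (X * A) := by rw [Matrix.transpose_mul, hX.symm_right, hY.symm_right]
      _ = Y * A := by rw [Matrix.mul_assoc, ← Matrix.mul_assoc A, hX.mul_mul_left]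
  calc X = X * A * X := hX.mul_mul_right.symm
    _ = Y * (A * X) := by rw [h2, Matrix.mul_assoc]
    _ = Y := by rw [h1, ← Matrix.mul_assoc, hY.mul_mul_right]

open Classical in
/-- The Moore–Penrose pseudo-inverse `A†`. -/
def pinv {ι : Type*} [Fintype ι] (A : Matrix ι ι ℝ) : Matrix ι ι ℝ :=
  if h : ∃ X, IsPseudoInverse A X then h.choose else 0

theorem pinv_spec {ι : Type*} [Fintype ι] [DecidableEq ι] {A : Matrix ι ι ℝ}
    (hA : A.IsHermitian) : IsPseudoInverse A (pinv A) := by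
  have h : ∃ X, IsPseudoInverse A X := by
    set U : Matrix ι ι ℝ := (hA.eigenvectorUnitary : Matrix ι ι ℝ) with hU
    have hUU : Uᵀ * U = 1 := by
      have := Unitary.coe_star_mul_self hA.eigenvectorUnitary
      simpa [Matrix.star_eq_conjTranspose, Matrix.conjTranspose_eq_transpose_of_trivial] using this
    set D : Matrix ι ι ℝ := Matrix.diagonal hA.eigenvalues with hD
    set D' : Matrix ι ι ℝ := Matrix.diagonal (fun i => (hA.eigenvalues i)⁻¹) with hD'
    have hAU : A = U * D * Uᵀ := by
      have := hA.spectral_theorem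
      simpa [Unitary.conjStarAlgAut_apply, Matrix.star_eq_conjTranspose,
        Matrix.conjTranspose_eq_transpose_of_trivial, Function.comp_def] using this
    have hmul : ∀ P Q : Matrix ι ι ℝ, (U * P * Uᵀ) * (U * Q * Uᵀ) = U * (P * Q) * Uᵀ := by
      intro P Q
      calc (U * P * Uᵀ) * (U * Q * Uᵀ) = U * P * (Uᵀ * U) * Q * Uᵀ := by
            simp only [Matrix.mul_assoc]
        _ = U * (P * Q) * Uᵀ := by rw [hUU]; simp only [Matrix.mul_assoc, Matrix.one_mul]
    refine ⟨U * D' * Uᵀ, ?_, ?_, ?_, ?_⟩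
    · rw [hAU, hmul, hmul, hD, hD', Matrix.diagonal_mul_diagonal, Matrix.diagonal_mul_diagonal]
      congr 3; funext i; exact mul_inv_mul_cancel _
    · rw [hAU, hmul, hmul, hD, hD', Matrix.diagonal_mul_diagonal, Matrix.diagonal_mul_diagonal]
      congr 3; funext i; by_cases h0 : hA.eigenvalues i = 0 <;> simp [h0]
    · rw [hAU, hmul, hD, hD', Matrix.diagonal_mul_diagonal]
      simp [Matrix.transpose_mul, Matrix.mul_assoc]
    · rw [hAU, hmul, hD, hD', Matrix.diagonal_mul_diagonal]
      simp [Matrix.transpose_mul, Matrix.mul_assoc]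
  rw [pinv, dif_pos h]
  exact h.choose_spec

/-- The squared Frobenius norm. -/
def frobSq {ι κ : Type*} [Fintype ι] [Fintype κ] (M : Matrix ι κ ℝ) : ℝ :=
  ∑ i, ∑ j, M i j ^ 2

/-! ### Control variates and objectives -/

/-- Indices `(t, j)` of the data points, `1 ≤ t ≤ T`, `1 ≤ j ≤ m_t`. -/
abbrev Idx {T : ℕ} (m : Fin T → ℕ) := Σ t : Fin T, Fin (m t)

/-- Coefficients `θ`: the row with index `(t, j)` is the vector `θ_{tj} ∈ ℝ^T`. -/
abbrev Coeff {T : ℕ} (m : Fin T → ℕ) := Matrix (Idx m) (Fin T) ℝ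

/-- The control variate `g_θ(z) = ∑_{t,j} K₀(z, x_{tj}) θ_{tj}`. -/
def controlVariate {d T : ℕ} {m : Fin T → ℕ} (K₀ : E d → E d → Matrix (Fin T) (Fin T) ℝ)
    (x : Idx m → E d) (θ : Coeff m) (z : E d) : Fin T → ℝ :=
  ∑ a, K₀ z (x a) *ᵥ θ a

/-- The empirical least-squares objective
`J(θ, β) = ∑_t (1/m_t) ∑_j (f_t(x_{tj}) - (g_θ(x_{tj}))_t - β_t)²`. -/
def leastSquares {d T : ℕ} {m : Fin T → ℕ} (K₀ : E d → E d → Matrix (Fin T) (Fin T) ℝ)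
    (x : Idx m → E d) (f : Fin T → E d → ℝ) (θ : Coeff m) (β : Fin T → ℝ) : ℝ :=
  ∑ t, (1 / (m t : ℝ)) * ∑ j : Fin (m t),
    (f t (x ⟨t, j⟩) - controlVariate K₀ x θ (x ⟨t, j⟩) t - β t) ^ 2

/-- The objective which learns `B`, for the base kernel `K = B k`:
`J(θ, β, B) + λ ‖g_θ‖²_{H_{K₀}} + ‖B‖_F²`. -/
def learnObjective {d T : ℕ} {m : Fin T → ℕ} (π : Fin T → E d → ℝ) (k : E d → E d → ℝ)
    (x : Idx m → E d) (f : Fin T → E d → ℝ) (lam : ℝ)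
    (θ : Coeff m) (β : Fin T → ℝ) (B : Matrix (Fin T) (Fin T) ℝ) : ℝ :=
  leastSquares (mvSteinKernel π (sepKernel B k)) x f θ β
    + lam * rkhsNorm (mvSteinKernel π (sepKernel B k))
        (controlVariate (mvSteinKernel π (sepKernel B k)) x θ) ^ 2
    + frobSq B

/-- The `δ`-regularised objective
`J(θ, β, I) + λ ∑_{a,b} Tr[B† (k₀(x_a, x_b) θ_a θ_bᵀ + δ² I)] + ‖B‖_F²`,
where `a, b` run over all the data indices and `p` is the density defining `k₀`. -/
def regObjective {d T : ℕ} {m : Fin T → ℕ} (π : Fin T → E d → ℝ) (p : E d → ℝ)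
    (k : E d → E d → ℝ) (x : Idx m → E d) (f : Fin T → E d → ℝ) (lam δ : ℝ)
    (θ : Coeff m) (β : Fin T → ℝ) (B : Matrix (Fin T) (Fin T) ℝ) : ℝ :=
  leastSquares (mvSteinKernel π (sepKernel 1 k)) x f θ β
    + lam * ∑ a, ∑ b, Matrix.trace (pinv B *
        (steinKernel p k (x a) (x b) • Matrix.vecMulVec (θ a) (θ b)
          + δ ^ 2 • (1 : Matrix (Fin T) (Fin T) ℝ)))
    + frobSq B

/-- The Gram matrix `(k₀(x_a, x_b))_{a,b}` of the data points. -/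
def gram {d T : ℕ} {m : Fin T → ℕ} (p : E d → ℝ) (k : E d → E d → ℝ) (x : Idx m → E d) :
    Matrix (Idx m) (Idx m) ℝ :=
  Matrix.of fun a b => steinKernel p k (x a) (x b)

/-- `q = (θ, B)` minimises `F` over all coefficients `θ` and all symmetric strictly positive
definite matrices `B`. -/
def IsMinimiser {T : ℕ} {m : Fin T → ℕ} (F : Coeff m → Matrix (Fin T) (Fin T) ℝ → ℝ)
    (q : Coeff m × Matrix (Fin T) (Fin T) ℝ) : Prop :=
  q.2.PosDef ∧ ∀ (θ : Coeff m) (B : Matrix (Fin T) (Fin T) ℝ), B.PosDef → F q.1 q.2 ≤ F θ B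

/-- `q = (θ, B)` is a minimiser of `F`, and `θ` has the least Frobenius norm among them. -/
def IsLeastNormMinimiser {T : ℕ} {m : Fin T → ℕ}
    (F : Coeff m → Matrix (Fin T) (Fin T) ℝ → ℝ)
    (q : Coeff m × Matrix (Fin T) (Fin T) ℝ) : Prop :=
  IsMinimiser F q ∧ ∀ q', IsMinimiser F q' → frobSq q.1 ≤ frobSq q'.1

/-- `q = (θ, B)` minimises `F` over all coefficients `θ` and all symmetric positive
semi-definite matrices `B`. -/
def IsSemidefMinimiser {T : ℕ} {m : Fin T → ℕ}
    (F : Coeff m → Matrix (Fin T) (Fin T) ℝ → ℝ)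
    (q : Coeff m × Matrix (Fin T) (Fin T) ℝ) : Prop :=
  q.2.PosSemidef ∧
    ∀ (θ : Coeff m) (B : Matrix (Fin T) (Fin T) ℝ), B.PosSemidef → F q.1 q.2 ≤ F θ B

end VVCV

end

open VVCV

namespace VVCV

/-! ### Quadratic trace forms -/

section LinearAlgebra

/-! Write `G` for the Gram matrix. The regularised objective is `penalised`, and its penalty `Tr (B†
θᵀ G θ)` is not continuous at singular `B`. It is, however, a supremum over `Φ` of functions
`dualForm G B θ Φ` that are affine in `(θ, B)`, obtained by completing the square and attained at `Φ
= θ B†`; likewise `Tr B†` is the case `G = 1`, `θ = 1`. So the objective is replaced by its closed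
epigraph `InEpigraph`, defined by these dual functions alone. Joint convexity follows at once
(`quadTrace_pinv_convex`), and the epigraph is closed under limits (`InEpigraph.of_tendsto`). A
finite level forces the rows of `G θ` into the range of `B`, and forces `B` to be invertible if the
trace weight `μ` is positive.

Sublevel sets bound `B` and `G θ`, but not `θ` along the kernel of `G`; compactness is therefore
applied to the projections `G† G θ`, which are also the coefficients of least norm. Uniqueness comes
from the strong convexity of `‖B‖_F²`, then from the quadratic form in `θ` for the common `B`
(`InEpigraph.unique`).

As `δ → 0`, a competitor `(η, C)` of the learning objective is compared with the minimisers through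
`(η C, C + δ I)`, whose trace penalty is `O(δ)`. Every accumulation point thus lies in the epigraph
for `μ = 0` below all values of the learning objective. The substitution `η = θ B†` shows that this
infimum is attained there, so the accumulation point is unique and the whole sequence converges.

The link with kernels is that `G` is positive semi-definite (a limit of finite-difference quadratic
forms of `k`) and that the squared RKHS norm of `g_θ` is `Tr (B θᵀ G θ)`. -/

theorem transpose_eq_of_isHermitian {ι : Type*} {A : Matrix ι ι ℝ} (hA : A.IsHermitian) : Aᵀ = A := by
  simpa [Matrix.conjTranspose_eq_transpose_of_trivial] using hA.eq

variable {ι κ : Type*} [Fintype ι] [Fintype κ]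

open scoped MatrixOrder in
theorem exists_eq_transpose_mul_self {A : Matrix ι ι ℝ} (hA : A.PosSemidef) :
    ∃ C : Matrix ι ι ℝ, A = Cᵀ * C := by
  classical
  obtain ⟨C, hC⟩ := CStarAlgebra.nonneg_iff_eq_star_mul_self.mp hA.nonneg
  exact ⟨C, by simpa [Matrix.star_eq_conjTranspose,
    Matrix.conjTranspose_eq_transpose_of_trivial] using hC⟩

/-- The quadratic form `Tr (B θᵀ G θ)`. -/
def quadTrace (G : Matrix ι ι ℝ) (B : Matrix κ κ ℝ) (θ : Matrix ι κ ℝ) : ℝ :=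
  Matrix.trace (B * (θᵀ * G * θ))

/-- The concave quadratic functions of `Φ` whose supremum is `Tr (B† θᵀ G θ)`. -/
def dualForm (G : Matrix ι ι ℝ) (B : Matrix κ κ ℝ) (θ Φ : Matrix ι κ ℝ) : ℝ :=
  2 * Matrix.trace (Φᵀ * (G * θ)) - quadTrace G B Φ

theorem frobSq_eq_trace (M : Matrix ι κ ℝ) : frobSq M = Matrix.trace (Mᵀ * M) := by
  simp only [frobSq, Matrix.trace, Matrix.diag, Matrix.mul_apply, Matrix.transpose_apply]
  rw [Finset.sum_comm]
  simp [sq]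

theorem frobSq_nonneg (M : Matrix ι κ ℝ) : 0 ≤ frobSq M :=
  Finset.sum_nonneg fun _ _ => Finset.sum_nonneg fun _ _ => sq_nonneg _

theorem frobSq_eq_zero {M : Matrix ι κ ℝ} (h : frobSq M = 0) : M = 0 := by
  ext i j
  have h1 := (Finset.sum_eq_zero_iff_of_nonneg
    (fun i _ => Finset.sum_nonneg fun j _ => sq_nonneg (M i j))).1 h i (Finset.mem_univ i)
  have h2 := (Finset.sum_eq_zero_iff_of_nonneg (fun j _ => sq_nonneg (M i j))).1 h1 j
    (Finset.mem_univ j)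
  simpa using h2

theorem frobSq_mul_le {ν : Type*} [Fintype ν] (A : Matrix ι κ ℝ) (B : Matrix κ ν ℝ) :
    frobSq (A * B) ≤ frobSq A * frobSq B := by
  have h : ∀ i j, (A * B) i j ^ 2 ≤ (∑ l, A i l ^ 2) * ∑ l, B l j ^ 2 := fun i j => by
    rw [Matrix.mul_apply]
    exact Finset.sum_mul_sq_le_sq_mul_sq _ _ _
  calc frobSq (A * B) ≤ ∑ i, ∑ j, (∑ l, A i l ^ 2) * ∑ l, B l j ^ 2 :=
        Finset.sum_le_sum fun i _ => Finset.sum_le_sum fun j _ => h i j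
    _ = frobSq A * frobSq B := by
        simp only [frobSq]
        rw [Finset.sum_comm (s := (Finset.univ : Finset κ)), Finset.sum_mul_sum]

theorem frobSq_transpose (A : Matrix ι κ ℝ) : frobSq Aᵀ = frobSq A := by
  simp only [frobSq, Matrix.transpose_apply]
  exact Finset.sum_comm

theorem trace_mul_sq_le (A : Matrix ι κ ℝ) (B : Matrix κ ι ℝ) :
    Matrix.trace (A * B) ^ 2 ≤ frobSq A * frobSq B := by
  have h := Finset.sum_mul_sq_le_sq_mul_sq (Finset.univ : Finset (ι × κ))
    (fun q => A q.1 q.2) (fun q => B q.2 q.1)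
  simp only [Fintype.sum_prod_type] at h
  rw [← frobSq_transpose B]
  simpa [frobSq, Matrix.trace, Matrix.mul_apply] using h

theorem abs_quadTrace_le (G : Matrix ι ι ℝ) (B : Matrix κ κ ℝ) (θ : Matrix ι κ ℝ) :
    |quadTrace G B θ| ≤ √(frobSq B * frobSq G) * frobSq θ := by
  have h1 := trace_mul_sq_le B (θᵀ * G * θ)
  have h2 : frobSq (θᵀ * G * θ) ≤ frobSq θ * frobSq G * frobSq θ := by
    refine (frobSq_mul_le _ _).trans ?_
    have := frobSq_mul_le θᵀ G
    rw [frobSq_transpose] at this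
    exact mul_le_mul_of_nonneg_right this (frobSq_nonneg _)
  refine abs_le_of_sq_le_sq ?_ (mul_nonneg (Real.sqrt_nonneg _) (frobSq_nonneg _))
  rw [mul_pow, Real.sq_sqrt (mul_nonneg (frobSq_nonneg _) (frobSq_nonneg _))]
  calc quadTrace G B θ ^ 2 ≤ frobSq B * frobSq (θᵀ * G * θ) := h1
    _ ≤ frobSq B * (frobSq θ * frobSq G * frobSq θ) :=
        mul_le_mul_of_nonneg_left h2 (frobSq_nonneg _)
    _ = _ := by ring

/-- Both the positivity of the form and its null vectors are read off from this factorisation. -/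
theorem quadTrace_eq_frobSq (C : Matrix ι ι ℝ) (D : Matrix κ κ ℝ) (θ : Matrix ι κ ℝ) :
    quadTrace (Cᵀ * C) (Dᵀ * D) θ = frobSq (C * θ * Dᵀ) := by
  rw [frobSq_eq_trace, quadTrace, Matrix.mul_assoc, Matrix.trace_mul_comm]
  simp only [Matrix.transpose_mul, Matrix.transpose_transpose]
  rw [Matrix.mul_assoc, Matrix.trace_mul_comm, Matrix.mul_assoc D, Matrix.trace_mul_comm D]
  congr 1
  simp only [Matrix.mul_assoc]

theorem quadTrace_nonneg {G : Matrix ι ι ℝ} {B : Matrix κ κ ℝ} (hG : G.PosSemidef)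
    (hB : B.PosSemidef) (θ : Matrix ι κ ℝ) : 0 ≤ quadTrace G B θ := by
  obtain ⟨C, rfl⟩ := exists_eq_transpose_mul_self hG
  obtain ⟨D, rfl⟩ := exists_eq_transpose_mul_self hB
  rw [quadTrace_eq_frobSq]
  exact frobSq_nonneg _

theorem mul_mul_eq_zero_of_quadTrace_eq_zero {G : Matrix ι ι ℝ} {B : Matrix κ κ ℝ}
    (hG : G.PosSemidef) (hB : B.PosSemidef) {θ : Matrix ι κ ℝ} (h : quadTrace G B θ = 0) :
    G * θ * B = 0 := by
  obtain ⟨C, rfl⟩ := exists_eq_transpose_mul_self hG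
  obtain ⟨D, rfl⟩ := exists_eq_transpose_mul_self hB
  rw [quadTrace_eq_frobSq] at h
  calc Cᵀ * C * θ * (Dᵀ * D) = Cᵀ * (C * θ * Dᵀ) * D := by simp only [Matrix.mul_assoc]
    _ = 0 := by rw [frobSq_eq_zero h]; simp

theorem quadTrace_eq_sum (G : Matrix ι ι ℝ) (B : Matrix κ κ ℝ) (θ : Matrix ι κ ℝ) :
    quadTrace G B θ
      = ∑ a, ∑ b, Matrix.trace (B * (G a b • Matrix.vecMulVec (θ a) (θ b))) := by
  have h : θᵀ * G * θ = ∑ a, ∑ b, G a b • Matrix.vecMulVec (θ a) (θ b) := by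
    ext i j
    simp only [Matrix.mul_apply, Matrix.sum_apply, Matrix.smul_apply, Matrix.vecMulVec_apply,
      Matrix.transpose_apply, smul_eq_mul, Finset.sum_mul]
    rw [Finset.sum_comm]
    exact Finset.sum_congr rfl fun a _ => Finset.sum_congr rfl fun b _ => by ring
  rw [quadTrace, h]
  simp only [Matrix.mul_sum, Matrix.trace_sum]

theorem quadTrace_congr {G : Matrix ι ι ℝ} (hG : G.IsHermitian) (B : Matrix κ κ ℝ)
    {θ θ' : Matrix ι κ ℝ} (h : G * θ = G * θ') : quadTrace G B θ = quadTrace G B θ' := by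
  have hG' := transpose_eq_of_isHermitian hG
  have h2 : θᵀ * G = θ'ᵀ * G := by
    have := congrArg Matrix.transpose h
    simpa [Matrix.transpose_mul, hG'] using this
  rw [quadTrace, quadTrace, h2, Matrix.mul_assoc θ'ᵀ, h, Matrix.mul_assoc θ'ᵀ]

theorem quadTrace_smul (G : Matrix ι ι ℝ) (B : Matrix κ κ ℝ) (s : ℝ) (θ : Matrix ι κ ℝ) :
    quadTrace G B (s • θ) = s ^ 2 * quadTrace G B θ := by
  simp [quadTrace, sq, mul_assoc]

theorem quadTrace_add_left (G : Matrix ι ι ℝ) (B B' : Matrix κ κ ℝ) (θ : Matrix ι κ ℝ) :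
    quadTrace G (B + B') θ = quadTrace G B θ + quadTrace G B' θ := by
  simp [quadTrace, add_mul]

theorem quadTrace_smul_left (G : Matrix ι ι ℝ) (s : ℝ) (B : Matrix κ κ ℝ) (θ : Matrix ι κ ℝ) :
    quadTrace G (s • B) θ = s * quadTrace G B θ := by
  simp [quadTrace]

theorem trace_cross_comm {G : Matrix ι ι ℝ} {B : Matrix κ κ ℝ} (hG : G.IsHermitian)
    (hB : B.IsHermitian) (θ Φ : Matrix ι κ ℝ) :
    Matrix.trace (B * (θᵀ * G * Φ)) = Matrix.trace (B * (Φᵀ * G * θ)) := by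
  rw [← Matrix.trace_transpose (B * (θᵀ * G * Φ))]
  simp only [Matrix.transpose_mul, Matrix.transpose_transpose, transpose_eq_of_isHermitian hG,
    transpose_eq_of_isHermitian hB]
  rw [Matrix.trace_mul_comm, ← Matrix.mul_assoc Φᵀ]

theorem quadTrace_add {G : Matrix ι ι ℝ} {B : Matrix κ κ ℝ} (hG : G.IsHermitian)
    (hB : B.IsHermitian) (θ Φ : Matrix ι κ ℝ) :
    quadTrace G B (θ + Φ)
      = quadTrace G B θ + 2 * Matrix.trace (B * (Φᵀ * G * θ)) + quadTrace G B Φ := by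
  have h : B * ((θ + Φ)ᵀ * G * (θ + Φ))
      = B * (θᵀ * G * θ) + B * (Φᵀ * G * θ) + B * (θᵀ * G * Φ) + B * (Φᵀ * G * Φ) := by
    simp only [Matrix.transpose_add, Matrix.add_mul, Matrix.mul_add]; abel
  rw [quadTrace, h, Matrix.trace_add, Matrix.trace_add, Matrix.trace_add,
    trace_cross_comm hG hB θ Φ, quadTrace, quadTrace]
  ring

theorem quadTrace_sub {G : Matrix ι ι ℝ} {B : Matrix κ κ ℝ} (hG : G.IsHermitian)
    (hB : B.IsHermitian) (θ Φ : Matrix ι κ ℝ) :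
    quadTrace G B (θ - Φ)
      = quadTrace G B θ - 2 * Matrix.trace (B * (Φᵀ * G * θ)) + quadTrace G B Φ := by
  have h := quadTrace_add hG hB θ (-Φ)
  have h2 : quadTrace G B (-Φ) = quadTrace G B Φ := by simp [quadTrace]
  rw [h2] at h
  simp only [Matrix.transpose_neg, Matrix.neg_mul, Matrix.mul_neg, Matrix.trace_neg] at h
  rw [sub_eq_add_neg, h]
  ring

theorem quadTrace_midpoint {G : Matrix ι ι ℝ} {B : Matrix κ κ ℝ} (hG : G.IsHermitian)
    (hB : B.IsHermitian) (θ Φ : Matrix ι κ ℝ) :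
    quadTrace G B ((1 / 2 : ℝ) • (θ + Φ))
      = 1 / 2 * quadTrace G B θ + 1 / 2 * quadTrace G B Φ - 1 / 4 * quadTrace G B (θ - Φ) := by
  rw [quadTrace_smul, quadTrace_add hG hB, quadTrace_sub hG hB]
  ring

theorem frobSq_convex_comb {a b : ℝ} (hab : a + b = 1) (M N : Matrix ι κ ℝ) :
    frobSq (a • M + b • N) = a * frobSq M + b * frobSq N - a * b * frobSq (M - N) := by
  obtain rfl : b = 1 - a := by linarith
  simp only [frobSq, Finset.mul_sum, ← Finset.sum_add_distrib, ← Finset.sum_sub_distrib]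
  refine Finset.sum_congr rfl fun i _ => Finset.sum_congr rfl fun j _ => ?_
  simp only [Matrix.add_apply, Matrix.smul_apply, Matrix.sub_apply, smul_eq_mul]
  ring

theorem dualForm_convex_comb (G : Matrix ι ι ℝ) {a b : ℝ}
    (B B' : Matrix κ κ ℝ) (θ θ' Φ : Matrix ι κ ℝ) :
    dualForm G (a • B + b • B') (a • θ + b • θ') Φ
      = a * dualForm G B θ Φ + b * dualForm G B' θ' Φ := by
  simp only [dualForm, quadTrace_add_left, quadTrace_smul_left, Matrix.mul_add, Matrix.mul_smul,
    Matrix.trace_add, Matrix.trace_smul, smul_eq_mul]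
  ring

/-- Completing the square: the difference of the two sides is `quadTrace G B (η - Φ)`. -/
theorem dualForm_mul_le {G : Matrix ι ι ℝ} {B : Matrix κ κ ℝ} (hG : G.PosSemidef)
    (hB : B.PosSemidef) (η Φ : Matrix ι κ ℝ) :
    dualForm G B (η * B) Φ ≤ quadTrace G B η := by
  have h := quadTrace_nonneg hG hB (η - Φ)
  rw [quadTrace_sub hG.isHermitian hB.isHermitian] at h
  have h2 : Matrix.trace (Φᵀ * (G * (η * B))) = Matrix.trace (B * (Φᵀ * G * η)) := by
    rw [Matrix.trace_mul_comm B]; simp only [Matrix.mul_assoc]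
  rw [dualForm, h2]
  linarith

theorem quadTrace_mul_of_mul_mul {G : Matrix ι ι ℝ} {B X : Matrix κ κ ℝ} (hX : X.IsHermitian)
    (hXBX : X * B * X = X) (θ : Matrix ι κ ℝ) :
    quadTrace G B (θ * X) = quadTrace G X θ := by
  rw [quadTrace, quadTrace, Matrix.transpose_mul, transpose_eq_of_isHermitian hX]
  calc (B * (X * θᵀ * G * (θ * X))).trace = ((B * (X * θᵀ * G * θ)) * X).trace := by
        simp only [Matrix.mul_assoc]
    _ = ((X * B * X) * (θᵀ * G * θ)).trace := by
        rw [Matrix.trace_mul_comm]; simp only [Matrix.mul_assoc]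
    _ = _ := by rw [hXBX]

/-- With `X = B†`, this is the attainment of the supremum of the dual forms, at `Φ = θ X`. -/
theorem dualForm_mul_of_mul_mul {G : Matrix ι ι ℝ} {B X : Matrix κ κ ℝ} (hX : X.IsHermitian)
    (hXBX : X * B * X = X) (θ : Matrix ι κ ℝ) :
    dualForm G B θ (θ * X) = quadTrace G X θ := by
  rw [dualForm, quadTrace_mul_of_mul_mul hX hXBX, Matrix.transpose_mul,
    transpose_eq_of_isHermitian hX, quadTrace]
  simp only [Matrix.mul_assoc]
  ring

/-! ### Pseudo-inverses of symmetric matrices -/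

theorem IsPseudoInverse.eq_pinv {A X : Matrix ι ι ℝ} (h : IsPseudoInverse A X) : pinv A = X := by
  have h' : ∃ X, IsPseudoInverse A X := ⟨X, h⟩
  rw [pinv, dif_pos h']
  exact h'.choose_spec.unique h

/-- Transposition exchanges the two symmetry equations of Penrose, so `(A†)ᵀ` is again a
pseudo-inverse of `A`. -/
theorem pinv_isHermitian {A : Matrix ι ι ℝ} (hA : A.IsHermitian) : (pinv A).IsHermitian := by
  classical
  have hs := pinv_spec hA
  have hA' := transpose_eq_of_isHermitian hA
  have h : IsPseudoInverse A (pinv A)ᵀ := by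
    refine ⟨?_, ?_, ?_, ?_⟩
    · have := congrArg Matrix.transpose hs.mul_mul_left
      simpa [Matrix.transpose_mul, hA', Matrix.mul_assoc] using this
    · have := congrArg Matrix.transpose hs.mul_mul_right
      simpa [Matrix.transpose_mul, hA', Matrix.mul_assoc] using this
    · have := hs.symm_right
      rw [Matrix.transpose_mul, hA'] at this
      rw [Matrix.transpose_mul, hA', Matrix.transpose_transpose, this]
    · have := hs.symm_left
      rw [Matrix.transpose_mul, hA'] at this
      rw [Matrix.transpose_mul, hA', Matrix.transpose_transpose, this]
  rw [Matrix.IsHermitian, Matrix.conjTranspose_eq_transpose_of_trivial]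
  exact h.unique hs

theorem mul_pinv_comm {A : Matrix ι ι ℝ} (hA : A.IsHermitian) : A * pinv A = pinv A * A := by
  classical
  have h := (pinv_spec hA).symm_right
  rwa [Matrix.transpose_mul, transpose_eq_of_isHermitian hA,
    transpose_eq_of_isHermitian (pinv_isHermitian hA)] at h

/-- `A† = A† A A†` is a congruence of `A`. -/
theorem pinv_posSemidef {A : Matrix ι ι ℝ} (hA : A.PosSemidef) : (pinv A).PosSemidef := by
  classical
  have h := hA.conjTranspose_mul_mul_same (pinv A)
  rwa [(pinv_isHermitian hA.isHermitian).eq, (pinv_spec hA.isHermitian).mul_mul_right] at h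

theorem pinv_eq_of_mul_eq_one [DecidableEq ι] {A X : Matrix ι ι ℝ} (h : X * A = 1) :
    pinv A = X := by
  have h' : A * X = 1 := mul_eq_one_comm.mp h
  exact IsPseudoInverse.eq_pinv ⟨by simp [h'], by simp [h], by simp [h'], by simp [h]⟩

theorem pinv_mul_self_of_posDef [DecidableEq ι] {A : Matrix ι ι ℝ} (hA : A.PosDef) :
    pinv A * A = 1 := by
  have h : A⁻¹ * A = 1 := Matrix.nonsing_inv_mul _ ((Matrix.isUnit_iff_isUnit_det _).1 hA.isUnit)
  rwa [pinv_eq_of_mul_eq_one h]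

/-- The dual form sees `θ` only through `G θ`, so the range condition allows `θ` to be replaced by
`η B` with `η = θ B†`. -/
theorem dualForm_le_quadTrace_pinv {G : Matrix ι ι ℝ} {B : Matrix κ κ ℝ} (hG : G.PosSemidef)
    (hB : B.PosSemidef) {θ : Matrix ι κ ℝ} (h : G * θ * pinv B * B = G * θ)
    (Φ : Matrix ι κ ℝ) : dualForm G B θ Φ ≤ quadTrace G (pinv B) θ := by
  classical
  have h1 : dualForm G B θ Φ = dualForm G B (θ * pinv B * B) Φ := by
    rw [dualForm, dualForm, ← h]; simp only [Matrix.mul_assoc]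
  rw [h1, ← quadTrace_mul_of_mul_mul (pinv_isHermitian hB.isHermitian)
    (pinv_spec hB.isHermitian).mul_mul_right]
  exact dualForm_mul_le hG hB _ _

/-- If the dual functions are bounded above, then the rows of `G θ` lie in the range of `B`. -/
theorem mul_pinv_mul_of_dualForm_le {G : Matrix ι ι ℝ} {B : Matrix κ κ ℝ}
    (hB : B.PosSemidef) {θ : Matrix ι κ ℝ} {c : ℝ}
    (h : ∀ Φ, dualForm G B θ Φ ≤ c) : G * θ * pinv B * B = G * θ := by
  classical
  set V := G * θ with hV
  -- The part of `G θ` outside the range of `B`. The quadratic term of the dual form vanishes on its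
  -- multiples, so there the dual form is linear and cannot be bounded unless `Ψ = 0`.
  set Ψ := V - V * pinv B * B with hΨ
  have hs := pinv_spec hB.isHermitian
  have hΨB : Ψ * B = 0 := by
    have h1 : V * pinv B * B * B = V * B := by
      rw [Matrix.mul_assoc V, ← mul_pinv_comm hB.isHermitian, Matrix.mul_assoc,
        hs.mul_mul_left]
    rw [hΨ, Matrix.sub_mul, h1, sub_self]
  have hquad : quadTrace G B Ψ = 0 := by
    rw [quadTrace, Matrix.trace_mul_comm, Matrix.mul_assoc, hΨB]
    simp
  have hBΨ : B * Ψᵀ = 0 := by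
    have := congrArg Matrix.transpose hΨB
    simpa [Matrix.transpose_mul, transpose_eq_of_isHermitian hB.isHermitian] using this
  have hcross : Matrix.trace (Ψᵀ * V) = frobSq Ψ := by
    have h1 : V = Ψ + V * pinv B * B := by rw [hΨ]; abel
    have h2 : Matrix.trace (Ψᵀ * (V * pinv B * B)) = 0 := by
      rw [← Matrix.mul_assoc, Matrix.trace_mul_comm, ← Matrix.mul_assoc, hBΨ]
      simp
    calc Matrix.trace (Ψᵀ * V) = Matrix.trace (Ψᵀ * (Ψ + V * pinv B * B)) := by rw [← h1]
      _ = frobSq Ψ := by rw [Matrix.mul_add, Matrix.trace_add, h2, add_zero, frobSq_eq_trace]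
  have hΨ0 : frobSq Ψ = 0 := by
    by_contra hne
    -- The multiple of `Ψ` at which the dual form equals `c + 1`.
    have h1 := h (((c + 1) / (2 * frobSq Ψ)) • Ψ)
    rw [dualForm, quadTrace_smul, hquad, Matrix.transpose_smul, Matrix.smul_mul,
      Matrix.trace_smul, ← hV, hcross, smul_eq_mul] at h1
    have h2 : 2 * ((c + 1) / (2 * frobSq Ψ) * frobSq Ψ) = c + 1 := by field_simp
    linarith
  have := frobSq_eq_zero hΨ0
  rw [hΨ, sub_eq_zero] at this
  exact this.symm

/-! ### Compactness -/

theorem continuous_frobSq : Continuous (frobSq : Matrix ι κ ℝ → ℝ) := by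
  unfold frobSq
  fun_prop

theorem continuous_quadTrace (G : Matrix ι ι ℝ) (θ : Matrix ι κ ℝ) :
    Continuous (fun B : Matrix κ κ ℝ => quadTrace G B θ) := by
  unfold quadTrace
  fun_prop

theorem isCompact_frobSq_le (c : ℝ) : IsCompact {M : Matrix ι κ ℝ | frobSq M ≤ c} := by
  have h : IsCompact (Set.univ.pi fun _ : ι => Set.univ.pi fun _ : κ => Set.Icc (-√c) √c) :=
    isCompact_univ_pi fun _ => isCompact_univ_pi fun _ => isCompact_Icc
  refine IsCompact.of_isClosed_subset (X := ι → κ → ℝ) h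
    (isClosed_le continuous_frobSq continuous_const) fun M hM => ?_
  simp only [Set.mem_univ_pi, Set.mem_Icc]
  intro i j
  have h1 : M i j ^ 2 ≤ frobSq M :=
    (Finset.single_le_sum (f := fun j => M i j ^ 2) (fun j _ => sq_nonneg _)
      (Finset.mem_univ j)).trans
      (Finset.single_le_sum (f := fun i => ∑ j, M i j ^ 2)
        (fun i _ => Finset.sum_nonneg fun j _ => sq_nonneg _) (Finset.mem_univ i))
  exact abs_le.1 (Real.abs_le_sqrt (h1.trans hM))

theorem tendsto_subseq_of_frobSq_le {ν ρ : Type*} [Fintype ν] [Fintype ρ] {c c' : ℝ}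
    (q : ℕ → Matrix ι κ ℝ × Matrix ν ρ ℝ) (h1 : ∀ n, frobSq (q n).1 ≤ c)
    (h2 : ∀ n, frobSq (q n).2 ≤ c') :
    ∃ (a : Matrix ι κ ℝ × Matrix ν ρ ℝ) (φ : ℕ → ℕ), StrictMono φ ∧
      Tendsto (q ∘ φ) atTop (𝓝 a) := by
  have : FirstCountableTopology (Matrix ι κ ℝ) :=
    inferInstanceAs (FirstCountableTopology (ι → κ → ℝ))
  have : FirstCountableTopology (Matrix ν ρ ℝ) :=
    inferInstanceAs (FirstCountableTopology (ν → ρ → ℝ))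
  obtain ⟨a, -, φ, hφ, hlim⟩ := ((isCompact_frobSq_le c).prod (isCompact_frobSq_le c')).tendsto_subseq
    (x := q) (fun n => ⟨h1 n, h2 n⟩)
  exact ⟨a, φ, hφ, hlim⟩

theorem isClosed_posSemidef : IsClosed {B : Matrix κ κ ℝ | B.PosSemidef} := by
  have h : {B : Matrix κ κ ℝ | B.PosSemidef}
      = {B | Bᵀ = B} ∩ ⋂ v : κ → ℝ, {B | 0 ≤ v ⬝ᵥ (B *ᵥ v)} := by
    ext B
    simp [Matrix.posSemidef_iff_dotProduct_mulVec, Matrix.IsHermitian,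
      Matrix.conjTranspose_eq_transpose_of_trivial]
  rw [h]
  refine (isClosed_eq (by fun_prop) continuous_id).inter (isClosed_iInter fun v => ?_)
  exact isClosed_le continuous_const (by fun_prop)

end LinearAlgebra

/-! ### The penalised matrix problem -/

section Penalised

variable {ι κ : Type*} [Fintype ι] [Fintype κ] [DecidableEq κ]

/-- The objective `j (G θ) + λ (Tr (B† θᵀ G θ) + μ Tr B†) + ‖B‖_F²`. -/
noncomputable def penalised (G : Matrix ι ι ℝ) (j : Matrix ι κ ℝ → ℝ) (lam μ : ℝ) (θ : Matrix ι κ ℝ)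
    (B : Matrix κ κ ℝ) : ℝ :=
  j (G * θ) + lam * (quadTrace G (pinv B) θ + μ * Matrix.trace (pinv B)) + frobSq B

/-- The functions whose supremum over `Φ` and `Ψ` is the penalised objective. -/
noncomputable def dualObjective (G : Matrix ι ι ℝ) (j : Matrix ι κ ℝ → ℝ) (lam μ : ℝ) (θ : Matrix ι κ ℝ)
    (B : Matrix κ κ ℝ) (Φ : Matrix ι κ ℝ) (Ψ : Matrix κ κ ℝ) : ℝ :=
  j (G * θ) + lam * (dualForm G B θ Φ + μ * dualForm 1 B 1 Ψ) + frobSq B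

/-- The closed epigraph of the penalised objective, extended by `∞` to the matrices `B` for which
the penalty is not finite. -/
structure InEpigraph (G : Matrix ι ι ℝ) (j : Matrix ι κ ℝ → ℝ) (lam μ : ℝ) (θ : Matrix ι κ ℝ)
    (B : Matrix κ κ ℝ) (c : ℝ) : Prop where
  posSemidef : B.PosSemidef
  le : ∀ Φ Ψ, dualObjective G j lam μ θ B Φ Ψ ≤ c

/-- The assumptions on the data of the penalised problem. -/
structure IsAdmissible (G : Matrix ι ι ℝ) (j : Matrix ι κ ℝ → ℝ) (lam : ℝ) : Prop where
  posSemidef : G.PosSemidef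
  convexOn : ConvexOn ℝ Set.univ j
  continuous : Continuous j
  nonneg : ∀ V, 0 ≤ j V
  pos : 0 < lam

variable {G : Matrix ι ι ℝ} {j : Matrix ι κ ℝ → ℝ} {lam μ : ℝ} {θ θ' : Matrix ι κ ℝ}
  {B B' : Matrix κ κ ℝ} {c c' : ℝ}

omit [DecidableEq κ] in
theorem dualForm_zero (G : Matrix ι ι ℝ) (B : Matrix κ κ ℝ) (θ : Matrix ι κ ℝ) :
    dualForm G B θ 0 = 0 := by
  simp [dualForm, quadTrace]

theorem quadTrace_one_one (B : Matrix κ κ ℝ) : quadTrace (1 : Matrix κ κ ℝ) B 1 = Matrix.trace B := by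
  simp [quadTrace]

theorem posDef_of_pinv_mul_self (hB : B.PosSemidef) (h : pinv B * B = 1) : B.PosDef :=
  hB.posDef_iff_isUnit.2 (IsUnit.of_mul_eq_one_right _ h)

theorem InEpigraph.mul_pinv_mul (h : IsAdmissible G j lam) (he : InEpigraph G j lam μ θ B c) :
    G * θ * pinv B * B = G * θ := by
  refine mul_pinv_mul_of_dualForm_le (c := (c - j (G * θ) - frobSq B) / lam) he.posSemidef
    fun Φ => ?_
  have h1 := he.le Φ 0
  rw [dualObjective, dualForm_zero] at h1
  rw [le_div_iff₀ h.pos]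
  linarith

/-- The trace penalty is a barrier: bounded dual functions for `G = 1`, `θ = 1` put the rows of the
identity in the range of `B`. -/
theorem InEpigraph.posDef (h : IsAdmissible G j lam) (hμ : 0 < μ)
    (he : InEpigraph G j lam μ θ B c) : B.PosDef := by
  have h1 := mul_pinv_mul_of_dualForm_le (G := (1 : Matrix κ κ ℝ)) (θ := 1)
    (c := (c - j (G * θ) - frobSq B) / (lam * μ)) he.posSemidef fun Ψ => by
      have h1 := he.le 0 Ψ
      rw [dualObjective, dualForm_zero] at h1
      rw [le_div_iff₀ (mul_pos h.pos hμ)]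
      linarith
  simp only [Matrix.mul_one, Matrix.one_mul] at h1
  exact posDef_of_pinv_mul_self he.posSemidef h1

theorem InEpigraph.penalised_le (he : InEpigraph G j lam μ θ B c) :
    penalised G j lam μ θ B ≤ c := by
  have h1 := he.le (θ * pinv B) (1 * pinv B)
  have hX := pinv_isHermitian he.posSemidef.isHermitian
  have hs := (pinv_spec he.posSemidef.isHermitian).mul_mul_right
  rwa [dualObjective, dualForm_mul_of_mul_mul hX hs, dualForm_mul_of_mul_mul hX hs,
    quadTrace_one_one] at h1

/-- Converse to `InEpigraph.penalised_le`. A singular `B` is harmless when `μ = 0`, since the `Ψ`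
term then drops out. -/
theorem inEpigraph_of_feasible (h : IsAdmissible G j lam) (hμ : 0 ≤ μ) (hB : B.PosSemidef)
    (hθ : G * θ * pinv B * B = G * θ) (hd : μ = 0 ∨ B.PosDef) :
    InEpigraph G j lam μ θ B (penalised G j lam μ θ B) := by
  refine ⟨hB, fun Φ Ψ => ?_⟩
  have h1 := dualForm_le_quadTrace_pinv h.posSemidef hB hθ Φ
  have h2 : μ * dualForm 1 B 1 Ψ ≤ μ * Matrix.trace (pinv B) := by
    rcases hd with rfl | hd
    · simp
    · rw [← quadTrace_one_one]
      refine mul_le_mul_of_nonneg_left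
        (dualForm_le_quadTrace_pinv Matrix.PosSemidef.one hB ?_ Ψ) hμ
      simpa using pinv_mul_self_of_posDef hd
  have h3 := mul_le_mul_of_nonneg_left (add_le_add h1 h2) h.pos.le
  rw [dualObjective, penalised]
  linarith

theorem inEpigraph_of_posDef (h : IsAdmissible G j lam) (hμ : 0 ≤ μ) (hB : B.PosDef) :
    InEpigraph G j lam μ θ B (penalised G j lam μ θ B) :=
  inEpigraph_of_feasible h hμ hB.posSemidef
    (by rw [Matrix.mul_assoc, pinv_mul_self_of_posDef hB, Matrix.mul_one]) (Or.inr hB)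

theorem InEpigraph.mono (he : InEpigraph G j lam μ θ B c) (hc : c ≤ c') :
    InEpigraph G j lam μ θ B c' :=
  ⟨he.posSemidef, fun Φ Ψ => (he.le Φ Ψ).trans hc⟩

/-- The dual functions are affine in `(θ, B)` and `j` is convex; the gain comes from the strong
convexity of `‖B‖_F²`. -/
theorem InEpigraph.midpoint (h : IsAdmissible G j lam) (he : InEpigraph G j lam μ θ B c)
    (he' : InEpigraph G j lam μ θ' B' c') :
    InEpigraph G j lam μ ((1 / 2 : ℝ) • θ + (1 / 2 : ℝ) • θ') ((1 / 2 : ℝ) • B + (1 / 2 : ℝ) • B')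
      (1 / 2 * c + 1 / 2 * c' - 1 / 4 * frobSq (B - B')) := by
  refine ⟨(he.posSemidef.smul (by norm_num)).add (he'.posSemidef.smul (by norm_num)),
    fun Φ Ψ => ?_⟩
  have h1 := he.le Φ Ψ
  have h2 := he'.le Φ Ψ
  have h3 : dualForm 1 ((1 / 2 : ℝ) • B + (1 / 2 : ℝ) • B') 1 Ψ
      = 1 / 2 * dualForm 1 B 1 Ψ + 1 / 2 * dualForm 1 B' 1 Ψ := by
    rw [← dualForm_convex_comb, ← add_smul]; norm_num
  have h4 := h.convexOn.2 (Set.mem_univ (G * θ)) (Set.mem_univ (G * θ'))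
    (show (0 : ℝ) ≤ 1 / 2 by norm_num) (show (0 : ℝ) ≤ 1 / 2 by norm_num) (by norm_num)
  rw [dualObjective] at h1 h2 ⊢
  rw [h3, dualForm_convex_comb, frobSq_convex_comb (by norm_num), Matrix.mul_add, Matrix.mul_smul,
    Matrix.mul_smul]
  simp only [smul_eq_mul] at h4
  linarith

/-- Points of the epigraph at the minimal level have the same `B` and the same `G θ`. -/
theorem InEpigraph.unique (h : IsAdmissible G j lam) (hμ : 0 ≤ μ)
    (he : InEpigraph G j lam μ θ B c) (he' : InEpigraph G j lam μ θ' B' c)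
    (hmin : ∀ θ'' B'' c'', InEpigraph G j lam μ θ'' B'' c'' → c ≤ c'') :
    G * θ = G * θ' ∧ B = B' := by
  have hB : B = B' := by
    have h1 := hmin _ _ _ (he.midpoint h he')
    have h2 : frobSq (B - B') = 0 := le_antisymm (by linarith) (frobSq_nonneg _)
    exact sub_eq_zero.1 (frobSq_eq_zero h2)
  subst hB
  refine ⟨?_, rfl⟩
  have hθ := he.mul_pinv_mul h
  have hθ' := he'.mul_pinv_mul h
  have hX := pinv_posSemidef he.posSemidef
  have hd : μ = 0 ∨ B.PosDef := by
    rcases hμ.eq_or_lt with h0 | h0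
    · exact Or.inl h0.symm
    · exact Or.inr (he.posDef h h0)
  -- For the common `B`, the midpoint of `θ` and `θ'` gains a quarter of `quadTrace G B† (θ - θ')`,
  -- which must therefore vanish.
  have hmid := hmin _ _ _ (inEpigraph_of_feasible h (θ := (1 / 2 : ℝ) • (θ + θ')) hμ he.posSemidef
    (by simp only [Matrix.mul_smul, Matrix.smul_mul, Matrix.mul_add, Matrix.add_mul, hθ, hθ']) hd)
  have h4 := h.convexOn.2 (Set.mem_univ (G * θ)) (Set.mem_univ (G * θ'))
    (show (0 : ℝ) ≤ 1 / 2 by norm_num) (show (0 : ℝ) ≤ 1 / 2 by norm_num) (by norm_num)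
  have h5 := he.penalised_le
  have h6 := he'.penalised_le
  rw [penalised] at h5 h6 hmid
  rw [quadTrace_midpoint h.posSemidef.isHermitian hX.isHermitian, Matrix.mul_smul, Matrix.mul_add,
    smul_add] at hmid
  simp only [smul_eq_mul] at h4
  have h7 : lam * quadTrace G (pinv B) (θ - θ') ≤ 0 := by linarith
  have h8 : quadTrace G (pinv B) (θ - θ') = 0 :=
    le_antisymm (nonpos_of_mul_nonpos_right h7 h.pos) (quadTrace_nonneg h.posSemidef hX _)
  have h9 := mul_mul_eq_zero_of_quadTrace_eq_zero h.posSemidef hX h8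
  -- The range condition recovers `G (θ - θ')` from `G (θ - θ') B† = 0`.
  have h10 : G * θ - G * θ' = G * (θ - θ') * pinv B * B := by
    rw [Matrix.mul_sub, Matrix.sub_mul, Matrix.sub_mul, hθ, hθ']
  rw [h9, Matrix.zero_mul] at h10
  exact sub_eq_zero.1 h10

/-- Each dual inequality is continuous in all the data, so it survives limits at which `B†` is
discontinuous. -/
theorem InEpigraph.of_tendsto (h : IsAdmissible G j lam) {θs : ℕ → Matrix ι κ ℝ}
    {Bs : ℕ → Matrix κ κ ℝ} {μs cs : ℕ → ℝ}
    (he : ∀ n, InEpigraph G j lam (μs n) (θs n) (Bs n) (cs n))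
    (hq : Tendsto (fun n => (θs n, Bs n)) atTop (𝓝 (θ, B))) (hμ : Tendsto μs atTop (𝓝 μ))
    (hc : Tendsto cs atTop (𝓝 c)) : InEpigraph G j lam μ θ B c := by
  have hB : Tendsto Bs atTop (𝓝 B) := (continuous_snd.tendsto _).comp hq
  have hθ : Tendsto θs atTop (𝓝 θ) := (continuous_fst.tendsto _).comp hq
  have hps : B.PosSemidef :=
    isClosed_posSemidef.mem_of_tendsto hB (Eventually.of_forall fun n => (he n).posSemidef)
  refine ⟨hps, fun Φ Ψ => ?_⟩
  have hG : Continuous fun θ : Matrix ι κ ℝ => j (G * θ) :=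
    h.continuous.comp (by fun_prop)
  have hd : Continuous fun θ : Matrix ι κ ℝ => 2 * Matrix.trace (Φᵀ * (G * θ)) := by fun_prop
  have hd1 : Continuous fun B : Matrix κ κ ℝ => dualForm (1 : Matrix κ κ ℝ) B 1 Ψ :=
    continuous_const.sub (continuous_quadTrace 1 Ψ)
  have h1 : Tendsto (fun n => dualForm G (Bs n) (θs n) Φ) atTop (𝓝 (dualForm G B θ Φ)) :=
    ((hd.tendsto θ).comp hθ).sub (((continuous_quadTrace G Φ).tendsto B).comp hB)
  have h2 : Tendsto (fun n => dualForm (1 : Matrix κ κ ℝ) (Bs n) 1 Ψ) atTop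
      (𝓝 (dualForm 1 B 1 Ψ)) := (hd1.tendsto B).comp hB
  have h3 : Tendsto (fun n => j (G * θs n)) atTop (𝓝 (j (G * θ))) := (hG.tendsto θ).comp hθ
  have h4 : Tendsto (fun n => frobSq (Bs n)) atTop (𝓝 (frobSq B)) :=
    (continuous_frobSq.tendsto B).comp hB
  have h5 := (h3.add ((h1.add (hμ.mul h2)).const_mul lam)).add h4
  exact le_of_tendsto_of_tendsto' h5 hc fun n => (he n).le Φ Ψ

theorem InEpigraph.frobSq_le (h : IsAdmissible G j lam) (he : InEpigraph G j lam μ θ B c) :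
    frobSq B ≤ c := by
  have h1 := he.le 0 0
  rw [dualObjective, dualForm_zero, dualForm_zero] at h1
  have := h.nonneg (G * θ)
  linarith

theorem InEpigraph.frobSq_mul_le (h : IsAdmissible G j lam) (he : InEpigraph G j lam μ θ B c) :
    frobSq (G * θ) ≤ (√(c * frobSq G) + 1) * (c / lam) := by
  set V := G * θ with hV
  -- `b` bounds the quadratic form of `G` and `B` relative to `‖·‖_F²`; the added `1` keeps it
  -- positive.
  set b := √(c * frobSq G) + 1 with hb
  have hb0 : 0 < b := by positivity
  -- At this `Φ` the linear term `2 b⁻¹ ‖V‖²` outweighs the quadratic term, which is at most `b⁻¹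
  -- ‖V‖²`.
  have h1 := he.le (b⁻¹ • V) 0
  have hj := h.nonneg V
  have hF := frobSq_nonneg B
  have hVV := frobSq_nonneg V
  have hquad : quadTrace G B V ≤ b * frobSq V := by
    refine (le_abs_self _).trans ((abs_quadTrace_le G B V).trans ?_)
    refine mul_le_mul_of_nonneg_right ?_ hVV
    have := Real.sqrt_le_sqrt (mul_le_mul_of_nonneg_right (he.frobSq_le h) (frobSq_nonneg G))
    linarith
  rw [dualObjective, dualForm_zero, dualForm, ← hV, quadTrace_smul, Matrix.transpose_smul,
    Matrix.smul_mul, Matrix.trace_smul, ← frobSq_eq_trace, smul_eq_mul] at h1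
  have h2 : b⁻¹ ^ 2 * quadTrace G B V ≤ b⁻¹ * frobSq V := by
    calc b⁻¹ ^ 2 * quadTrace G B V ≤ b⁻¹ ^ 2 * (b * frobSq V) :=
          mul_le_mul_of_nonneg_left hquad (by positivity)
      _ = b⁻¹ * frobSq V := by field_simp
  have h3 : lam * (b⁻¹ * frobSq V) ≤ c := by
    have := mul_le_mul_of_nonneg_left h2 h.pos.le
    linarith
  have h4 : b * (c / lam) = c * (b / lam) := by ring
  calc frobSq V = lam * (b⁻¹ * frobSq V) * (b / lam) := by
        have := h.pos.ne'
        field_simp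
    _ ≤ c * (b / lam) := mul_le_mul_of_nonneg_right h3 (div_pos hb0 h.pos).le
    _ = _ := h4.symm

/-! ### Coefficients of least norm -/

omit [Fintype κ] [DecidableEq κ] in
theorem mul_pinv_mul_mul (hG : G.PosSemidef) (θ : Matrix ι κ ℝ) :
    G * (pinv G * (G * θ)) = G * θ := by
  classical
  rw [← Matrix.mul_assoc, ← Matrix.mul_assoc, (pinv_spec hG.isHermitian).mul_mul_left]

omit [DecidableEq κ] in
-- Pythagoras: `G† G` is the orthogonal projection onto the range of `G`, so `G† G θ` has least norm
-- among the coefficients with the same `G θ`.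
theorem frobSq_eq_add_pinv_mul_mul (hG : G.PosSemidef) (θ : Matrix ι κ ℝ) :
    frobSq θ = frobSq (pinv G * (G * θ)) + frobSq (θ - pinv G * (G * θ)) := by
  classical
  set η := pinv G * (G * θ) with hη
  have hG' := transpose_eq_of_isHermitian hG.isHermitian
  have hX' := transpose_eq_of_isHermitian (pinv_isHermitian hG.isHermitian)
  have h1 : ηᵀ * (θ - η) = 0 := by
    have h2 : ηᵀ = θᵀ * pinv G * G := by
      rw [hη, Matrix.transpose_mul, Matrix.transpose_mul, hX', hG', Matrix.mul_assoc,
        mul_pinv_comm hG.isHermitian, Matrix.mul_assoc]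
    rw [h2, Matrix.mul_assoc, Matrix.mul_sub, hη, mul_pinv_mul_mul hG, sub_self, Matrix.mul_zero]
  have h2 : (θ - η)ᵀ * η = 0 := by
    have := congrArg Matrix.transpose h1
    simpa [Matrix.transpose_mul] using this
  have h3 : θᵀ * θ = ηᵀ * η + (θ - η)ᵀ * (θ - η) + ηᵀ * (θ - η) + (θ - η)ᵀ * η := by
    simp only [Matrix.transpose_sub, Matrix.sub_mul, Matrix.mul_sub]
    abel
  rw [frobSq_eq_trace, h3, h1, h2, add_zero, add_zero, Matrix.trace_add, ← frobSq_eq_trace,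
    ← frobSq_eq_trace]

omit [DecidableEq κ] in
theorem penalised_congr (hG : G.PosSemidef) (h : G * θ = G * θ') :
    penalised G j lam μ θ B = penalised G j lam μ θ' B := by
  rw [penalised, penalised, h, quadTrace_congr hG.isHermitian _ h]

theorem InEpigraph.congr (he : InEpigraph G j lam μ θ B c) (h : G * θ = G * θ') :
    InEpigraph G j lam μ θ' B c := by
  refine ⟨he.posSemidef, fun Φ Ψ => ?_⟩
  have := he.le Φ Ψ
  rw [dualObjective, dualForm] at this ⊢
  rwa [← h]

/-- The levels `ds` are quantified after the limit point, so that one subsequence serves all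
competitors at once in `exists_subseq_tendsto_limit`. -/
theorem InEpigraph.subseq_tendsto (h : IsAdmissible G j lam) {θs : ℕ → Matrix ι κ ℝ}
    {Bs : ℕ → Matrix κ κ ℝ} {μs cs : ℕ → ℝ}
    (he : ∀ n, InEpigraph G j lam (μs n) (θs n) (Bs n) (cs n))
    (hc : ∀ n, cs n ≤ c) (hμ : Tendsto μs atTop (𝓝 μ)) :
    ∃ (θ : Matrix ι κ ℝ) (B : Matrix κ κ ℝ) (φ : ℕ → ℕ), StrictMono φ ∧
      Tendsto (fun n => (pinv G * (G * θs (φ n)), Bs (φ n))) atTop (𝓝 (θ, B)) ∧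
      pinv G * (G * θ) = θ ∧
      ∀ (ds : ℕ → ℝ) (d : ℝ), (∀ n, InEpigraph G j lam (μs n) (θs n) (Bs n) (ds n)) →
        Tendsto ds atTop (𝓝 d) → InEpigraph G j lam μ θ B d := by
  obtain ⟨⟨θ, B⟩, φ, hφ, hlim⟩ := tendsto_subseq_of_frobSq_le
    (c := frobSq (pinv G) * ((√(c * frobSq G) + 1) * (c / lam))) (c' := c)
    (fun n => (pinv G * (G * θs n), Bs n))
    (fun n => (VVCV.frobSq_mul_le _ _).trans (mul_le_mul_of_nonneg_left
      (((he n).mono (hc n)).frobSq_mul_le h) (frobSq_nonneg _)))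
    (fun n => ((he n).mono (hc n)).frobSq_le h)
  refine ⟨θ, B, φ, hφ, hlim, ?_, fun ds d hds hd => InEpigraph.of_tendsto h
    (fun n => (hds (φ n)).congr (mul_pinv_mul_mul h.posSemidef _).symm) hlim
    (hμ.comp hφ.tendsto_atTop) (hd.comp hφ.tendsto_atTop)⟩
  have h1 : Tendsto (fun n => pinv G * (G * θs (φ n))) atTop (𝓝 θ) :=
    (continuous_fst.tendsto _).comp hlim
  have hcont : Continuous fun M : Matrix ι κ ℝ => pinv G * (G * M) := by fun_prop
  refine tendsto_nhds_unique ?_ h1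
  have h2 := (hcont.tendsto θ).comp h1
  refine h2.congr fun n => ?_
  simp only [Function.comp_apply, mul_pinv_mul_mul h.posSemidef]

end Penalised

/-! ### Existence and uniqueness of minimisers for positive trace weight -/

section Minimisers

variable {ι κ : Type*} [Fintype ι] [Fintype κ] [DecidableEq κ]
  {G : Matrix ι ι ℝ} {j : Matrix ι κ ℝ → ℝ} {lam μ : ℝ} {θ θ' : Matrix ι κ ℝ}
  {B B' : Matrix κ κ ℝ}

omit [DecidableEq κ] in
theorem penalised_nonneg (h : IsAdmissible G j lam) (hμ : 0 ≤ μ) (hB : B.PosSemidef) :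
    0 ≤ penalised G j lam μ θ B :=
  add_nonneg (add_nonneg (h.nonneg _) (mul_nonneg h.pos.le
    (add_nonneg (quadTrace_nonneg h.posSemidef (pinv_posSemidef hB) _)
      (mul_nonneg hμ (pinv_posSemidef hB).trace_nonneg)))) (frobSq_nonneg _)

theorem exists_minimiser_penalised (h : IsAdmissible G j lam) (hμ : 0 < μ) :
    ∃ (θ : Matrix ι κ ℝ) (B : Matrix κ κ ℝ), B.PosDef ∧ pinv G * (G * θ) = θ ∧
      ∀ θ' B', B'.PosDef → penalised G j lam μ θ B ≤ penalised G j lam μ θ' B' := by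
  set S : Set ℝ := {v | ∃ (θ : Matrix ι κ ℝ) (B : Matrix κ κ ℝ),
    B.PosDef ∧ penalised G j lam μ θ B = v} with hS
  have hne : S.Nonempty := ⟨_, 0, 1, Matrix.PosDef.one, rfl⟩
  have hbdd : BddBelow S := ⟨0, by
    rintro _ ⟨θ, B, hB, rfl⟩
    exact penalised_nonneg h hμ.le hB.posSemidef⟩
  obtain ⟨u, hu, hlim, hmem⟩ := exists_seq_tendsto_sInf hne hbdd
  choose θs Bs hBs hval using hmem
  have he : ∀ n, InEpigraph G j lam μ (θs n) (Bs n) (u n) := fun n => by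
    rw [← hval n]; exact inEpigraph_of_posDef h hμ.le (hBs n)
  -- The minimising sequence of values is antitone, so its first term bounds all levels; the barrier
  -- then makes the limit positive definite.
  obtain ⟨θ, B, φ, -, -, hθ, hE⟩ := InEpigraph.subseq_tendsto h he
    (fun n => hu (Nat.zero_le n)) (tendsto_const_nhds (x := μ))
  have hE' := hE u _ he hlim
  exact ⟨θ, B, hE'.posDef h hμ, hθ, fun θ' B' hB' =>
    hE'.penalised_le.trans (csInf_le hbdd ⟨θ', B', hB', rfl⟩)⟩

theorem minimiser_penalised_unique (h : IsAdmissible G j lam) (hμ : 0 < μ)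
    (hB : B.PosDef) (hB' : B'.PosDef)
    (hmin : ∀ θ'' B'', B''.PosDef → penalised G j lam μ θ B ≤ penalised G j lam μ θ'' B'')
    (hmin' : ∀ θ'' B'', B''.PosDef → penalised G j lam μ θ' B' ≤ penalised G j lam μ θ'' B'') :
    G * θ = G * θ' ∧ B = B' :=
  InEpigraph.unique h hμ.le (inEpigraph_of_posDef h hμ.le hB)
    ((inEpigraph_of_posDef h hμ.le hB').mono (hmin' _ _ hB))
    fun _ _ _ he => (hmin _ _ (he.posDef h hμ)).trans he.penalised_le

/-! ### The limit of vanishing regularisation -/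

omit [DecidableEq κ] in
/-- The objective `j (G η C) + λ Tr (C ηᵀ G η) + ‖C‖_F²`. -/
noncomputable def limitObjective (G : Matrix ι ι ℝ) (j : Matrix ι κ ℝ → ℝ) (lam : ℝ)
    (η : Matrix ι κ ℝ) (C : Matrix κ κ ℝ) : ℝ :=
  j (G * η * C) + lam * quadTrace G C η + frobSq C

/-- The change of variable `η = θ B†` that links the penalised problem at `μ = 0` with the learning
objective. -/
theorem limitObjective_mul_pinv (hB : B.PosSemidef) (hθ : G * θ * pinv B * B = G * θ) :
    limitObjective G j lam (θ * pinv B) B = penalised G j lam 0 θ B := by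
  rw [limitObjective, penalised, ← Matrix.mul_assoc G, hθ, zero_mul, add_zero,
    quadTrace_mul_of_mul_mul (pinv_isHermitian hB.isHermitian)
    (pinv_spec hB.isHermitian).mul_mul_right]

omit [Fintype κ] in
theorem posDef_add_smul_one [Finite κ] {C : Matrix κ κ ℝ} (hC : C.PosSemidef) {ε : ℝ}
    (hε : 0 < ε) : (C + ε • (1 : Matrix κ κ ℝ)).PosDef :=
  Matrix.PosDef.posSemidef_add hC (Matrix.PosDef.one.smul hε)

/-- With `X = (C + ε I)⁻¹`, take traces in `X C + ε X = I` and drop `Tr (C X) ≥ 0`. -/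
theorem mul_trace_pinv_add_smul_one_le {C : Matrix κ κ ℝ} (hC : C.PosSemidef) {ε : ℝ}
    (hε : 0 < ε) : ε * Matrix.trace (pinv (C + ε • (1 : Matrix κ κ ℝ))) ≤ Fintype.card κ := by
  have hD := posDef_add_smul_one hC hε
  set X := pinv (C + ε • (1 : Matrix κ κ ℝ)) with hX
  have h1 : X * C + ε • X = 1 := by
    rw [← pinv_mul_self_of_posDef hD, Matrix.mul_add]
    simp [hX]
  have h2 : 0 ≤ Matrix.trace (C * X) := by
    have := quadTrace_nonneg (pinv_posSemidef hD.posSemidef) hC (1 : Matrix κ κ ℝ)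
    simpa [quadTrace] using this
  have h3 := congrArg Matrix.trace h1
  rw [Matrix.trace_add, Matrix.trace_smul, Matrix.trace_one, smul_eq_mul,
    Matrix.trace_mul_comm] at h3
  linarith

/-- Enlarging the matrix lowers each dual form, hence the supremum. -/
theorem quadTrace_pinv_add_smul_one_le (hG : G.PosSemidef) {C : Matrix κ κ ℝ} (hC : C.PosSemidef)
    {ε : ℝ} (hε : 0 < ε) (η : Matrix ι κ ℝ) :
    quadTrace G (pinv (C + ε • (1 : Matrix κ κ ℝ))) (η * C) ≤ quadTrace G C η := by
  have hD := posDef_add_smul_one hC hε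
  rw [← dualForm_mul_of_mul_mul (pinv_isHermitian hD.isHermitian)
    (pinv_spec hD.isHermitian).mul_mul_right]
  refine le_trans ?_ (dualForm_mul_le hG hC η (η * C * pinv (C + ε • (1 : Matrix κ κ ℝ))))
  rw [dualForm, dualForm, quadTrace_add_left, quadTrace_smul_left]
  have := mul_nonneg hε.le (quadTrace_nonneg hG Matrix.PosSemidef.one
    (η * C * pinv (C + ε • (1 : Matrix κ κ ℝ))))
  linarith

/-- The shift of `C` by `δ I` makes the competitor admissible; against the weight `w δ²` its trace
penalty is at most `w δ` times the dimension. -/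
theorem penalised_add_smul_one_le (h : IsAdmissible G j lam) {C : Matrix κ κ ℝ}
    (hC : C.PosSemidef) {w δ : ℝ} (hw : 0 ≤ w) (hδ : 0 < δ) (η : Matrix ι κ ℝ) :
    penalised G j lam (w * δ ^ 2) (η * C) (C + δ • (1 : Matrix κ κ ℝ))
      ≤ j (G * η * C) + lam * (quadTrace G C η + w * δ * Fintype.card κ)
        + frobSq (C + δ • (1 : Matrix κ κ ℝ)) := by
  have h1 := quadTrace_pinv_add_smul_one_le h.posSemidef hC hδ η
  have h2 := mul_le_mul_of_nonneg_left (mul_trace_pinv_add_smul_one_le hC hδ)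
    (mul_nonneg hw hδ.le)
  have h3 : w * δ ^ 2 * Matrix.trace (pinv (C + δ • (1 : Matrix κ κ ℝ)))
      = w * δ * (δ * Matrix.trace (pinv (C + δ • (1 : Matrix κ κ ℝ)))) := by ring
  rw [penalised, h3, Matrix.mul_assoc]
  have := mul_le_mul_of_nonneg_left (add_le_add h1 h2) h.pos.le
  linarith

theorem tendsto_limitObjective {C : Matrix κ κ ℝ} {η : Matrix ι κ ℝ} (w : ℝ)
    {δ : ℕ → ℝ} (hδ : Tendsto δ atTop (𝓝 0)) :
    Tendsto (fun n => j (G * η * C) + lam * (quadTrace G C η + w * δ n * Fintype.card κ)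
        + frobSq (C + δ n • (1 : Matrix κ κ ℝ))) atTop (𝓝 (limitObjective G j lam η C)) := by
  have hF : Continuous fun t : ℝ => frobSq (C + t • (1 : Matrix κ κ ℝ)) :=
    continuous_frobSq.comp (by fun_prop)
  have h : Continuous fun t : ℝ => j (G * η * C)
      + lam * (quadTrace G C η + w * t * Fintype.card κ) + frobSq (C + t • (1 : Matrix κ κ ℝ)) := by
    fun_prop
  have := (h.tendsto 0).comp hδ
  simpa [limitObjective, Function.comp_def] using this

/-- Minimisers of the regularised problems accumulate at a solution of the limit problem. -/
theorem exists_subseq_tendsto_limit (h : IsAdmissible G j lam) {w : ℝ} (hw : 0 < w) {δ : ℕ → ℝ}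
    (hδ : ∀ n, 0 < δ n) (hδ0 : Tendsto δ atTop (𝓝 0))
    (q : ℕ → Matrix ι κ ℝ × Matrix κ κ ℝ) (hq : ∀ n, (q n).2.PosDef)
    (hmin : ∀ n θ' B', B'.PosDef → penalised G j lam (w * δ n ^ 2) (q n).1 (q n).2
      ≤ penalised G j lam (w * δ n ^ 2) θ' B') :
    ∃ (θ : Matrix ι κ ℝ) (B : Matrix κ κ ℝ) (φ : ℕ → ℕ), StrictMono φ ∧
      Tendsto (fun n => (pinv G * (G * (q (φ n)).1), (q (φ n)).2)) atTop (𝓝 (θ, B)) ∧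
      pinv G * (G * θ) = θ ∧
      ∀ (η : Matrix ι κ ℝ) (C : Matrix κ κ ℝ), C.PosSemidef →
        InEpigraph G j lam 0 θ B (limitObjective G j lam η C) := by
  have he : ∀ (η : Matrix ι κ ℝ) (C : Matrix κ κ ℝ), C.PosSemidef → ∀ n,
      InEpigraph G j lam (w * δ n ^ 2) (q n).1 (q n).2
        (j (G * η * C) + lam * (quadTrace G C η + w * δ n * Fintype.card κ)
          + frobSq (C + δ n • (1 : Matrix κ κ ℝ))) := fun η C hC n =>
    (inEpigraph_of_posDef h (mul_nonneg hw.le (sq_nonneg _)) (hq n)).mono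
      ((hmin n _ _ (posDef_add_smul_one hC (hδ n))).trans
        (penalised_add_smul_one_le h hC hw.le (hδ n) η))
  -- The zero competitor gives convergent, hence uniformly bounded, levels, as compactness requires.
  obtain ⟨c, hc⟩ := (tendsto_limitObjective (G := G) (j := j) (lam := lam) (η := 0)
    (C := (0 : Matrix κ κ ℝ)) w hδ0).bddAbove_range
  have hμ : Tendsto (fun n => w * δ n ^ 2) atTop (𝓝 0) := by
    simpa using (hδ0.pow 2).const_mul w
  obtain ⟨θ, B, φ, hφ, hlim, hθ, hE⟩ := InEpigraph.subseq_tendsto h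
    (he 0 0 Matrix.PosSemidef.zero) (fun n => hc ⟨n, rfl⟩) hμ
  exact ⟨θ, B, φ, hφ, hlim, hθ, fun η C hC => hE _ _ (he η C hC) (tendsto_limitObjective w hδ0)⟩

/-- Any epigraph point `(θ'', B'')` at `μ = 0` gives the competitor `(θ'' B''†, B'')`, so both
points sit at the minimal level and `InEpigraph.unique` applies. -/
theorem limit_unique (h : IsAdmissible G j lam)
    (he : ∀ (η : Matrix ι κ ℝ) (C : Matrix κ κ ℝ), C.PosSemidef →
        InEpigraph G j lam 0 θ B (limitObjective G j lam η C))
    (he' : ∀ (η : Matrix ι κ ℝ) (C : Matrix κ κ ℝ), C.PosSemidef →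
        InEpigraph G j lam 0 θ' B' (limitObjective G j lam η C)) :
    G * θ = G * θ' ∧ B = B' := by
  have h0 := he 0 0 Matrix.PosSemidef.zero
  have hθ := h0.mul_pinv_mul h
  have hv := limitObjective_mul_pinv (j := j) (lam := lam) h0.posSemidef hθ
  refine InEpigraph.unique h le_rfl (inEpigraph_of_feasible h le_rfl h0.posSemidef hθ (Or.inl rfl))
    (hv ▸ he' _ _ h0.posSemidef) fun θ'' B'' c'' h'' => ?_
  have h1 := (he (θ'' * pinv B'') B'' h''.posSemidef).penalised_le
  rw [limitObjective_mul_pinv h''.posSemidef (h''.mul_pinv_mul h)] at h1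
  exact h1.trans h''.penalised_le

theorem exists_limit_minimisers (h : IsAdmissible G j lam) {w : ℝ} (hw : 0 < w) :
    ∃ (θ : Matrix ι κ ℝ) (B : Matrix κ κ ℝ), B.PosSemidef ∧ pinv G * (G * θ) = θ ∧
      G * θ * pinv B * B = G * θ ∧
      (∀ (η : Matrix ι κ ℝ) (C : Matrix κ κ ℝ), C.PosSemidef →
        penalised G j lam 0 θ B ≤ limitObjective G j lam η C) ∧
      ∀ δ : ℕ → ℝ, (∀ n, 0 < δ n) → Tendsto δ atTop (𝓝 0) →
        ∀ q : ℕ → Matrix ι κ ℝ × Matrix κ κ ℝ, (∀ n, (q n).2.PosDef) →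
        (∀ n θ' B', B'.PosDef → penalised G j lam (w * δ n ^ 2) (q n).1 (q n).2
          ≤ penalised G j lam (w * δ n ^ 2) θ' B') →
        Tendsto (fun n => (pinv G * (G * (q n).1), (q n).2)) atTop (𝓝 (θ, B)) := by
  have hex : ∀ n : ℕ, ∃ q : Matrix ι κ ℝ × Matrix κ κ ℝ, q.2.PosDef ∧ ∀ θ' B', B'.PosDef →
      penalised G j lam (w * (1 / ((n : ℝ) + 1)) ^ 2) q.1 q.2
        ≤ penalised G j lam (w * (1 / ((n : ℝ) + 1)) ^ 2) θ' B' := fun n => by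
    obtain ⟨θ, B, hB, -, hmin⟩ := exists_minimiser_penalised h
      (show 0 < w * (1 / ((n : ℝ) + 1)) ^ 2 by positivity)
    exact ⟨(θ, B), hB, hmin⟩
  choose q hq hmin using hex
  obtain ⟨θ, B, -, -, -, hθ, hE⟩ := exists_subseq_tendsto_limit h hw
    (fun n => Nat.one_div_pos_of_nat) tendsto_one_div_add_atTop_nhds_zero_nat q hq hmin
  have h0 := hE 0 0 Matrix.PosSemidef.zero
  refine ⟨θ, B, h0.posSemidef, hθ, h0.mul_pinv_mul h, fun η C hC => (hE η C hC).penalised_le,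
    fun δ hδ hδ0 q hq hmin => tendsto_of_subseq_tendsto fun ns hns => ?_⟩
  obtain ⟨θ', B', φ, -, hlim, hθ', hE'⟩ := exists_subseq_tendsto_limit h hw
    (fun n => hδ (ns n)) (hδ0.comp hns) (fun n => q (ns n)) (fun n => hq (ns n))
    (fun n => hmin (ns n))
  -- Uniqueness only gives equal `G θ`; both limits are fixed by `G† G`, so the coefficients agree
  -- too.
  obtain ⟨h1, rfl⟩ := limit_unique h hE hE'
  rw [← hθ', ← h1, hθ] at hlim
  exact ⟨φ, hlim⟩

/-! ### Joint convexity -/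

/-- The value at the combination is attained by a single `Φ`, for which the dual form is affine in
`(θ, B)`. -/
theorem quadTrace_pinv_convex (hG : G.PosSemidef) (hB : B.PosDef) (hB' : B'.PosDef) {a b : ℝ}
    (ha : 0 ≤ a) (hb : 0 ≤ b) (hD : (a • B + b • B').PosDef) (θ θ' : Matrix ι κ ℝ) :
    quadTrace G (pinv (a • B + b • B')) (a • θ + b • θ')
      ≤ a * quadTrace G (pinv B) θ + b * quadTrace G (pinv B') θ' := by
  rw [← dualForm_mul_of_mul_mul (pinv_isHermitian hD.isHermitian)
    (pinv_spec hD.isHermitian).mul_mul_right, dualForm_convex_comb]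
  refine add_le_add (mul_le_mul_of_nonneg_left (dualForm_le_quadTrace_pinv hG hB.posSemidef ?_ _) ha)
    (mul_le_mul_of_nonneg_left (dualForm_le_quadTrace_pinv hG hB'.posSemidef ?_ _) hb)
  · rw [Matrix.mul_assoc, pinv_mul_self_of_posDef hB, Matrix.mul_one]
  · rw [Matrix.mul_assoc, pinv_mul_self_of_posDef hB', Matrix.mul_one]

omit [Fintype κ] [DecidableEq κ] in
theorem convex_posDef : Convex ℝ {B : Matrix κ κ ℝ | B.PosDef} := by
  intro B hB B' hB' a b ha hb hab
  rcases ha.eq_or_lt with rfl | ha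
  · obtain rfl : b = 1 := by linarith
    simpa using hB'
  · exact Matrix.PosDef.add_posSemidef (hB.smul ha) (hB'.posSemidef.smul hb)

end Minimisers

/-! ### Scalar kernels and their Stein kernels -/

section Kernels

variable {d : ℕ}

/-- A measure fixes its density almost everywhere; continuity makes this everywhere. -/
theorem IsTarget.density_eq {μ : Measure (E d)} {p q : E d → ℝ} (hp : IsTarget μ p)
    (hq : IsTarget μ q) : p = q := by
  have hcp : Continuous fun x => ENNReal.ofReal (p x) :=
    ENNReal.continuous_ofReal.comp hp.contDiff.continuous
  have hcq : Continuous fun x => ENNReal.ofReal (q x) :=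
    ENNReal.continuous_ofReal.comp hq.contDiff.continuous
  have h1 : volume.withDensity (fun x => ENNReal.ofReal (p x))
      = volume.withDensity (fun x => ENNReal.ofReal (q x)) := hp.density.symm.trans hq.density
  have h2 := (withDensity_eq_iff_of_sigmaFinite hcp.measurable.aemeasurable
    hcq.measurable.aemeasurable).1 h1
  have h3 := (Continuous.ae_eq_iff_eq volume hcp hcq).1 h2
  funext x
  exact (ENNReal.ofReal_eq_ofReal_iff (hp.pos x).le (hq.pos x).le).1 (congrFun h3 x)

theorem IsKernel.sum_nonneg {k : E d → E d → ℝ} (hk : IsKernel k) {ι : Type*} [Fintype ι]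
    (c : ι → ℝ) (x : ι → E d) : 0 ≤ ∑ i, ∑ j, c i * c j * k (x i) (x j) := by
  let e := (Fintype.equivFin ι).symm
  have h := hk.nonneg _ (c ∘ e) (x ∘ e)
  simp only [Function.comp_apply] at h
  rw [← Equiv.sum_comp e]
  simpa only [← Equiv.sum_comp e (fun j => c (e _) * c j * k (x (e _)) (x j))] using h

/-! ### Finite differences and positivity of the Stein kernel -/

theorem hasDerivAt_add_smul_of_lineDifferentiableAt {g : E d → ℝ} {v : E d}
    (hg : ∀ z, LineDifferentiableAt ℝ g z v) (z : E d) (t : ℝ) :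
    HasDerivAt (fun s : ℝ => g (z + s • v)) (lineDeriv ℝ g (z + t • v) v) t := by
  have h : HasDerivAt (fun s : ℝ => g (z + t • v + s • v)) (lineDeriv ℝ g (z + t • v) v) (t - t) := by
    rw [sub_self]; exact (hg (z + t • v)).hasLineDerivAt
  have h2 := h.comp_sub_const t t
  refine h2.congr_of_eventuallyEq (Eventually.of_forall fun s => ?_)
  simp only [add_assoc, ← add_smul]
  congr 3
  ring

theorem exists_lineDeriv_eq_sub {g : E d → ℝ} {v : E d} (hg : ∀ z, LineDifferentiableAt ℝ g z v)
    (z : E d) {h : ℝ} (hh : 0 < h) :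
    ∃ s ∈ Set.Ioo 0 h, g (z + h • v) - g z = h * lineDeriv ℝ g (z + s • v) v := by
  have hd := hasDerivAt_add_smul_of_lineDifferentiableAt hg z
  obtain ⟨s, hs, heq⟩ := exists_hasDerivAt_eq_slope (fun s : ℝ => g (z + s • v)) _ hh
    (fun t _ => (hd t).continuousAt.continuousWithinAt) (fun t _ => hd t)
  refine ⟨s, hs, ?_⟩
  rw [heq]
  simp only [zero_smul, add_zero, sub_zero]
  field_simp

/-- The mean value theorem twice: in `y` for the difference of `k` at `x + h v` and `x`, then in `x`
for `pdY r k`. -/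
theorem IsC11.exists_mixed_eq {k : E d → E d → ℝ} (hk : IsC11 k) (r : Fin d) (x y : E d) {h : ℝ}
    (hh : 0 < h) : ∃ s ∈ Set.Ioo 0 h, ∃ t ∈ Set.Ioo 0 h,
      k (x + h • EuclideanSpace.single r 1) (y + h • EuclideanSpace.single r 1)
        - k x (y + h • EuclideanSpace.single r 1) - k (x + h • EuclideanSpace.single r 1) y + k x y
      = h ^ 2 * pdX r (pdY r k) (x + s • EuclideanSpace.single r 1)
          (y + t • EuclideanSpace.single r 1) := by
  set v : E d := EuclideanSpace.single r 1 with hv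
  have hlin : ∀ z, HasLineDerivAt ℝ (fun z => k (x + h • v) z - k x z)
      (pdY r k (x + h • v) z - pdY r k x z) z v := fun z =>
    (hk.diffY r (x + h • v) z).hasLineDerivAt.sub (hk.diffY r x z).hasLineDerivAt
  obtain ⟨t, ht, h1⟩ := exists_lineDeriv_eq_sub (fun z => (hlin z).lineDifferentiableAt) y hh
  obtain ⟨s, hs, h2⟩ := exists_lineDeriv_eq_sub (fun z => hk.diffXY r z (y + t • v)) x hh
  rw [(hlin _).lineDeriv] at h1
  refine ⟨s, hs, t, ht, ?_⟩
  have h3 : pdX r (pdY r k) (x + s • v) (y + t • v)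
      = lineDeriv ℝ (fun z => pdY r k z (y + t • v)) (x + s • v) v := rfl
  rw [h3]
  have h4 := h1.trans (congrArg (h * ·) h2)
  linarith [h4]

theorem IsC11.tendsto_mixed {k : E d → E d → ℝ} (hk : IsC11 k) (r : Fin d) (x y : E d) :
    Tendsto (fun h : ℝ => (k (x + h • EuclideanSpace.single r 1) (y + h • EuclideanSpace.single r 1)
        - k x (y + h • EuclideanSpace.single r 1) - k (x + h • EuclideanSpace.single r 1) y + k x y)
          / h ^ 2) (𝓝[>] 0) (𝓝 (pdX r (pdY r k) x y)) := by
  have hex : ∀ h : ℝ, ∃ q : ℝ × ℝ, 0 < h → q.1 ∈ Set.Ioo 0 h ∧ q.2 ∈ Set.Ioo 0 h ∧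
      (k (x + h • EuclideanSpace.single r 1) (y + h • EuclideanSpace.single r 1)
        - k x (y + h • EuclideanSpace.single r 1) - k (x + h • EuclideanSpace.single r 1) y + k x y)
          / h ^ 2 = pdX r (pdY r k) (x + q.1 • EuclideanSpace.single r 1)
            (y + q.2 • EuclideanSpace.single r 1) := by
    intro h
    by_cases hh : 0 < h
    · obtain ⟨s, hs, t, ht, heq⟩ := hk.exists_mixed_eq r x y hh
      refine ⟨(s, t), fun _ => ⟨hs, ht, ?_⟩⟩
      rw [heq]
      field_simp
    · exact ⟨0, fun h0 => absurd h0 hh⟩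
  choose q hq using hex
  have hid : Tendsto (fun h : ℝ => h) (𝓝[>] 0) (𝓝 0) := tendsto_nhdsWithin_of_tendsto_nhds tendsto_id
  have hpos : ∀ᶠ h : ℝ in 𝓝[>] 0, 0 < h := self_mem_nhdsWithin
  have h1 : Tendsto (fun h => (q h).1) (𝓝[>] 0) (𝓝 0) :=
    tendsto_of_tendsto_of_tendsto_of_le_of_le' tendsto_const_nhds hid
      (hpos.mono fun h hh => (hq h hh).1.1.le) (hpos.mono fun h hh => (hq h hh).1.2.le)
  have h2 : Tendsto (fun h => (q h).2) (𝓝[>] 0) (𝓝 0) :=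
    tendsto_of_tendsto_of_tendsto_of_le_of_le' tendsto_const_nhds hid
      (hpos.mono fun h hh => (hq h hh).2.1.1.le) (hpos.mono fun h hh => (hq h hh).2.1.2.le)
  have hc : Continuous fun s : ℝ × ℝ => pdX r (pdY r k) (x + s.1 • EuclideanSpace.single r 1)
      (y + s.2 • EuclideanSpace.single r 1) :=
    (hk.continuous_pd r).comp (f := fun s : ℝ × ℝ => ((x + s.1 • EuclideanSpace.single r 1 : E d),
      (y + s.2 • EuclideanSpace.single r 1 : E d))) (by fun_prop)
  have h3 := (hc.tendsto (0, 0)).comp (h1.prodMk_nhds h2)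
  simp only [zero_smul, add_zero] at h3
  exact h3.congr' (hpos.mono fun h hh => ((hq h hh).2.2).symm)

theorem IsC11.tendsto_slope {k : E d → E d → ℝ} (hk : IsC11 k) (r : Fin d) (x y : E d) :
    Tendsto (fun h : ℝ => (k x (y + h • EuclideanSpace.single r 1) - k x y) / h) (𝓝[>] 0)
      (𝓝 (pdY r k x y)) := by
  have h := (hk.diffY r x y).hasLineDerivAt.tendsto_slope_zero_right
  refine h.congr fun t => ?_
  rw [smul_eq_mul, div_eq_inv_mul]

theorem IsKernel.pdX_eq {k : E d → E d → ℝ} (hk : IsKernel k) (r : Fin d) (x y : E d) :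
    pdX r k x y = pdY r k y x := by
  rw [pdX, pdY]
  congr 1
  funext z
  exact hk.symm z y

/-- The mixed difference quotient is itself symmetric under exchange of the points. -/
theorem pdX_pdY_symm {k : E d → E d → ℝ} (hk : IsKernel k) (hk' : IsC11 k) (r : Fin d)
    (x y : E d) : pdX r (pdY r k) x y = pdX r (pdY r k) y x := by
  refine tendsto_nhds_unique (hk'.tendsto_mixed r x y) ((hk'.tendsto_mixed r y x).congr fun h => ?_)
  rw [hk.symm y x, hk.symm (y + _) (x + _), hk.symm y (x + _), hk.symm (y + _) x]
  ring

theorem steinKernel_symm {k : E d → E d → ℝ} (hk : IsKernel k) (hk' : IsC11 k) (p : E d → ℝ)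
    (x y : E d) : steinKernel p k x y = steinKernel p k y x := by
  simp only [steinKernel, hk.pdX_eq]
  rw [Finset.sum_congr rfl fun r _ => pdX_pdY_symm hk hk' r x y, hk.symm x y,
    Finset.sum_congr rfl fun r _ => mul_comm (score p x r) (score p y r)]
  ring

theorem sum_stein_term_nonneg {k : E d → E d → ℝ} (hk : IsKernel k) (hk' : IsC11 k) (r : Fin d)
    {ι : Type*} [Fintype ι] (c l : ι → ℝ) (x : ι → E d) :
    0 ≤ ∑ i, ∑ j, c i * c j * (pdX r (pdY r k) (x i) (x j) + l i * pdY r k (x i) (x j)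
      + l j * pdX r k (x i) (x j) + l i * l j * k (x i) (x j)) := by
  set v : E d := EuclideanSpace.single r 1 with hv
  have hlim : Tendsto (fun h : ℝ => ∑ i, ∑ j, c i * c j *
      ((k (x i + h • v) (x j + h • v) - k (x i) (x j + h • v) - k (x i + h • v) (x j)
          + k (x i) (x j)) / h ^ 2
        + l i * ((k (x i) (x j + h • v) - k (x i) (x j)) / h)
        + l j * ((k (x j) (x i + h • v) - k (x j) (x i)) / h) + l i * l j * k (x i) (x j)))
      (𝓝[>] 0) (𝓝 (∑ i, ∑ j, c i * c j * (pdX r (pdY r k) (x i) (x j)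
        + l i * pdY r k (x i) (x j) + l j * pdX r k (x i) (x j) + l i * l j * k (x i) (x j)))) := by
    refine tendsto_finsetSum _ fun i _ => tendsto_finsetSum _ fun j _ => Tendsto.const_mul _ ?_
    rw [hk.pdX_eq]
    exact (((hk'.tendsto_mixed r _ _).add ((hk'.tendsto_slope r _ _).const_mul _)).add
      ((hk'.tendsto_slope r _ _).const_mul _)).add tendsto_const_nhds
  refine ge_of_tendsto hlim (Eventually.mono self_mem_nhdsWithin fun h (hh : 0 < h) => ?_)
  -- These weights, at the points `x i + h v` and `x i`, discretise the functional `g ↦ ∑ c i (∂^r g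
  -- + l i g) (x i)`.
  have hsum := hk.sum_nonneg (ι := ι ⊕ ι)
    (Sum.elim (fun i => c i / h) fun i => c i * (l i - 1 / h)) (Sum.elim (fun i => x i + h • v) x)
  refine hsum.trans_eq ?_
  simp only [Fintype.sum_sum_type, Sum.elim_inl, Sum.elim_inr, ← Finset.sum_add_distrib]
  refine Finset.sum_congr rfl fun i _ => Finset.sum_congr rfl fun j _ => ?_
  rw [hk.symm (x j) (x i + h • v), hk.symm (x j) (x i)]
  field_simp
  ring

theorem gram_steinKernel_posSemidef {k : E d → E d → ℝ} (hk : IsKernel k) (hk' : IsC11 k)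
    (p : E d → ℝ) {ι : Type*} [Fintype ι] (x : ι → E d) :
    (Matrix.of fun a b => steinKernel p k (x a) (x b)).PosSemidef := by
  refine Matrix.PosSemidef.of_dotProduct_mulVec_nonneg ?_ fun c => ?_
  · ext a b
    simpa using steinKernel_symm hk hk' p (x b) (x a)
  · have h := Finset.sum_nonneg fun (r : Fin d) (_ : r ∈ Finset.univ) =>
      sum_stein_term_nonneg hk hk' r c (fun i => score p (x i) r) x
    refine h.trans_eq ?_
    rw [Finset.sum_comm]
    simp only [dotProduct, Matrix.mulVec, Matrix.of_apply, star_trivial, Finset.mul_sum]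
    refine Finset.sum_congr rfl fun i _ => ?_
    rw [Finset.sum_comm]
    refine Finset.sum_congr rfl fun j _ => ?_
    rw [steinKernel, ← Finset.mul_sum]
    simp only [Finset.sum_add_distrib, Finset.sum_mul]
    ring

theorem mvSteinKernel_sepKernel {T : ℕ} (p : E d → ℝ) (k : E d → E d → ℝ)
    (B : Matrix (Fin T) (Fin T) ℝ) (y z : E d) :
    mvSteinKernel (fun _ => p) (sepKernel B k) y z = steinKernel p k y z • B := by
  have hX : ∀ (g : E d → E d → ℝ) (b : ℝ) (r : Fin d) (y z : E d),
      pdX r (fun y z => g y z * b) y z = pdX r g y z * b := fun g b r y z => by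
    simp [pdX, lineDeriv]
  have hY : ∀ (g : E d → E d → ℝ) (b : ℝ) (r : Fin d) (y z : E d),
      pdY r (fun y z => g y z * b) y z = pdY r g y z * b := fun g b r y z => by
    simp [pdY, lineDeriv]
  ext t t'
  simp only [mvSteinKernel, sepKernel, Matrix.of_apply, Matrix.smul_apply, smul_eq_mul, hX]
  have hY' : ∀ r, pdY r (fun y z => k y z * B t t') = fun y z => pdY r k y z * B t t' :=
    fun r => by funext y z; exact hY k _ r y z
  simp only [hY', hX, steinKernel, Finset.sum_mul, ← Finset.sum_add_distrib, add_mul]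
  exact Finset.sum_congr rfl fun r _ => by ring

end Kernels

/-! ### The norm in the reproducing kernel Hilbert space -/

section RKHSNorm

variable {d T : ℕ}

theorem trace_mul_smul_vecMulVec {κ : Type*} [Fintype κ] (B : Matrix κ κ ℝ) (g : ℝ)
    (u v : κ → ℝ) : Matrix.trace (B * (g • Matrix.vecMulVec u v)) = g * (v ⬝ᵥ (B *ᵥ u)) := by
  rw [Matrix.mul_smul, Matrix.trace_smul, Matrix.mul_vecMulVec, Matrix.trace_vecMulVec,
    dotProduct_comm, smul_eq_mul]

theorem inner_toEuclideanCLM (M : Matrix (Fin T) (Fin T) ℝ) (u v : EuclideanSpace ℝ (Fin T)) :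
    inner ℝ (Matrix.toEuclideanCLM (𝕜 := ℝ) M u) v = v.ofLp ⬝ᵥ (M *ᵥ u.ofLp) := by
  rw [EuclideanSpace.inner_eq_star_dotProduct]
  simp [Matrix.ofLp_toEuclideanCLM]

/-- On a finitely supported test vector the form is `quadTrace` of `B` and the scalar Gram matrix of
the support. -/
theorem opKernel_posSemidef {k : E d → E d → ℝ} {B : Matrix (Fin T) (Fin T) ℝ}
    (hk : ∀ (s : Finset (E d)), (Matrix.of fun a b : s => k a b).PosSemidef)
    (hsymm : ∀ x y, k x y = k y x) (hB : B.PosSemidef) :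
    (opKernel fun x y => k x y • B).PosSemidef := by
  have key := (RKHS.posSemidef_tfae (K := opKernel fun x y => k x y • B)).out 0 2
  refine key.2 ⟨?_, fun vv => ?_⟩
  · refine Matrix.ext fun x y => ?_
    rw [Matrix.conjTranspose_apply, opKernel, Matrix.of_apply, Matrix.of_apply, ← map_star,
      star_smul, Matrix.star_eq_conjTranspose, hB.isHermitian.eq, star_trivial, hsymm]
  · have h := quadTrace_nonneg (hk vv.support) hB
      (Matrix.of fun (a : vv.support) (t : Fin T) => (vv a).ofLp t)
    rw [quadTrace_eq_sum] at h
    simp only [trace_mul_smul_vecMulVec] at h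
    refine h.trans_eq ?_
    rw [RCLike.re_to_real, Finsupp.sum]
    simp only [Finsupp.sum, opKernel, Matrix.of_apply, inner_toEuclideanCLM]
    rw [← Finset.sum_coe_sort vv.support]
    refine Finset.sum_congr rfl fun a _ => ?_
    rw [← Finset.sum_coe_sort vv.support]
    refine Finset.sum_congr rfl fun b _ => ?_
    rw [Matrix.smul_mulVec, dotProduct_smul, smul_eq_mul, hsymm]
    rfl

theorem rkhsNorm_sq_eq {K : E d → E d → Matrix (Fin T) (Fin T) ℝ}
    (hK : (opKernel K).PosSemidef) {ι : Type*} [Fintype ι] (x : ι → E d)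
    (θ : Matrix ι (Fin T) ℝ) :
    rkhsNorm K (fun z => ∑ a, K z (x a) *ᵥ θ a) ^ 2
      = ∑ a, ∑ b, θ a ⬝ᵥ (K (x a) (x b) *ᵥ θ b) := by
  have hfact : Fact (opKernel K).PosSemidef := ⟨hK⟩
  set u : RKHS.OfKernel (opKernel K) :=
    ∑ a, RKHS.kerFun (RKHS.OfKernel (opKernel K)) (x a) (WithLp.toLp 2 (θ a)) with hu
  have hcoe : ∀ z, u z = WithLp.toLp 2 (∑ a, K z (x a) *ᵥ θ a) := fun z => by
    have h1 : u z = ∑ a, (RKHS.kerFun (RKHS.OfKernel (opKernel K)) (x a) (WithLp.toLp 2 (θ a))) z := by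
      rw [hu, ← RKHS.coeCLM_apply (𝕜 := ℝ), map_sum, Finset.sum_apply]
      rfl
    rw [h1, WithLp.toLp_sum]
    refine Finset.sum_congr rfl fun a _ => ?_
    rw [RKHS.kerFun_apply, RKHS.OfKernel.kernel_ofKernel, opKernel, Matrix.of_apply]
    simp
  have hex : ∃ u : RKHS.OfKernel (opKernel K), ∀ z, u z = WithLp.toLp 2 (∑ a, K z (x a) *ᵥ θ a) :=
    ⟨u, hcoe⟩
  have hnorm : rkhsNorm K (fun z => ∑ a, K z (x a) *ᵥ θ a) = ‖u‖ := by
    rw [rkhsNorm, dif_pos hK, dif_pos hex]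
    congr 1
    -- Elements of the RKHS are determined by their values, so the chosen representative is `u`.
    exact RKHS.ext fun z => (hex.choose_spec z).trans (hcoe z).symm
  rw [hnorm, ← real_inner_self_eq_norm_sq]
  nth_rewrite 1 [hu]
  rw [sum_inner]
  refine Finset.sum_congr rfl fun a _ => ?_
  rw [RKHS.kerFun_inner, hcoe, EuclideanSpace.inner_eq_star_dotProduct]
  simp [dotProduct_comm, dotProduct_sum]

end RKHSNorm

/-! ### The objectives in terms of the Gram matrix -/

section Objectives

variable {d T : ℕ} {m : Fin T → ℕ}

/-- The least-squares objective, as a function of the fitted values at the data points. -/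
noncomputable def dataFit (x : Idx m → E d) (f : Fin T → E d → ℝ) (β : Fin T → ℝ)
    (V : Coeff m) : ℝ :=
  ∑ t, (1 / (m t : ℝ)) * ∑ j : Fin (m t), (f t (x ⟨t, j⟩) - V ⟨t, j⟩ t - β t) ^ 2

theorem dataFit_nonneg (x : Idx m → E d) (f : Fin T → E d → ℝ) (β : Fin T → ℝ) (V : Coeff m) :
    0 ≤ dataFit x f β V := by
  unfold dataFit
  positivity

theorem continuous_dataFit (x : Idx m → E d) (f : Fin T → E d → ℝ) (β : Fin T → ℝ) :
    Continuous (dataFit (m := m) x f β) := by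
  unfold dataFit
  fun_prop

theorem dataFit_convex (x : Idx m → E d) (f : Fin T → E d → ℝ) {a b : ℝ} (ha : 0 ≤ a)
    (hb : 0 ≤ b) (hab : a + b = 1) (β β' : Fin T → ℝ) (V V' : Coeff m) :
    dataFit x f (a • β + b • β') (a • V + b • V') ≤ a * dataFit x f β V + b * dataFit x f β' V' := by
  simp only [dataFit, Finset.mul_sum, ← Finset.sum_add_distrib]
  refine Finset.sum_le_sum fun t _ => Finset.sum_le_sum fun j _ => ?_
  obtain rfl : b = 1 - a := by linarith
  have h : ∀ u v : ℝ, (a * u + (1 - a) * v) ^ 2 ≤ a * u ^ 2 + (1 - a) * v ^ 2 := fun u v => by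
    have := mul_nonneg (mul_nonneg ha hb) (sq_nonneg (u - v))
    linarith
  have hw : (0 : ℝ) ≤ 1 / (m t : ℝ) := by positivity
  have h2 := mul_le_mul_of_nonneg_left (h (f t (x ⟨t, j⟩) - V ⟨t, j⟩ t - β t)
    (f t (x ⟨t, j⟩) - V' ⟨t, j⟩ t - β' t)) hw
  simp only [Matrix.add_apply, Matrix.smul_apply, Pi.add_apply, Pi.smul_apply, smul_eq_mul]
  refine le_trans (le_of_eq ?_) (h2.trans (le_of_eq ?_)) <;> ring

theorem isAdmissible_dataFit {G : Matrix (Idx m) (Idx m) ℝ} (hG : G.PosSemidef) {lam : ℝ}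
    (hlam : 0 < lam) (x : Idx m → E d) (f : Fin T → E d → ℝ) (β : Fin T → ℝ) :
    IsAdmissible G (dataFit x f β) lam where
  posSemidef := hG
  convexOn := ⟨convex_univ, fun V _ V' _ a b ha hb hab => by
    have h := dataFit_convex x f ha hb hab β β V V'
    rwa [← add_smul, hab, one_smul] at h⟩
  continuous := continuous_dataFit x f β
  nonneg := dataFit_nonneg x f β
  pos := hlam

variable (p : E d → ℝ) (k : E d → E d → ℝ) (x : Idx m → E d) (f : Fin T → E d → ℝ)

/-- Coefficients are stored as rows, so `B θ_a` becomes a row of `θ * B` by the symmetry of `B`. -/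
theorem leastSquares_eq_dataFit {B : Matrix (Fin T) (Fin T) ℝ} (hB : B.IsHermitian) (θ : Coeff m)
    (β : Fin T → ℝ) :
    leastSquares (fun y z => steinKernel p k y z • B) x f θ β
      = dataFit x f β (gram p k x * θ * B) := by
  have h : ∀ b t, controlVariate (fun y z => steinKernel p k y z • B) x θ (x b) t
      = (gram p k x * θ * B) b t := fun b t => by
    have hB' := transpose_eq_of_isHermitian hB
    simp only [controlVariate, Finset.sum_apply, Matrix.smul_mulVec, Pi.smul_apply, smul_eq_mul,
      Matrix.mul_assoc (gram p k x)]
    rw [Matrix.mul_apply]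
    refine Finset.sum_congr rfl fun a _ => ?_
    rw [gram, Matrix.of_apply, Matrix.mul_apply, Matrix.mulVec, dotProduct]
    congr 1
    refine Finset.sum_congr rfl fun s _ => ?_
    rw [mul_comm, ← hB', Matrix.transpose_apply, hB']
  simp only [leastSquares, dataFit, h]

theorem regObjective_eq_penalised (hm : ∀ t, 0 < m t) : ∃ w : ℝ, 0 < w ∧
    ∀ (lam δ : ℝ) (θ : Coeff m) (β : Fin T → ℝ) (B : Matrix (Fin T) (Fin T) ℝ),
      regObjective (fun _ => p) p k x f lam δ θ β B
        = penalised (gram p k x) (dataFit x f β) lam (w * δ ^ 2) θ B := by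
  have key : ∀ (lam δ : ℝ) (θ : Coeff m) (β : Fin T → ℝ) (B : Matrix (Fin T) (Fin T) ℝ),
      regObjective (fun _ => p) p k x f lam δ θ β B = penalised (gram p k x) (dataFit x f β) lam
        ((Fintype.card (Idx m) : ℝ) ^ 2 * δ ^ 2) θ B := fun lam δ θ β B => by
    have h1 : mvSteinKernel (fun _ : Fin T => p) (sepKernel 1 k)
        = fun y z => steinKernel p k y z • (1 : Matrix (Fin T) (Fin T) ℝ) :=
      funext fun y => funext fun z => mvSteinKernel_sepKernel p k 1 y z
    rw [regObjective, penalised, h1, leastSquares_eq_dataFit p k x f Matrix.isHermitian_one,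
      Matrix.mul_one, quadTrace_eq_sum]
    simp only [Matrix.mul_add, Matrix.trace_add, Finset.sum_add_distrib, Matrix.mul_smul,
      Matrix.mul_one, Matrix.trace_smul, smul_eq_mul, Finset.sum_const, Finset.card_univ,
      nsmul_eq_mul, gram, Matrix.of_apply]
    ring
  -- The term `δ² I` occurs once per pair of data indices, which gives `w`. For `T = 0` that count
  -- is zero, but the trace also vanishes and any `w` serves.
  rcases isEmpty_or_nonempty (Fin T) with hT | ⟨⟨t⟩⟩
  · refine ⟨1, one_pos, fun lam δ θ β B => ?_⟩
    rw [key, penalised, penalised]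
    simp [Matrix.trace]
  · have : Nonempty (Idx m) := ⟨⟨t, 0, hm t⟩⟩
    exact ⟨(Fintype.card (Idx m) : ℝ) ^ 2, by positivity, key⟩

variable {p k x f}

theorem learnObjective_eq_limitObjective (hk : IsKernel k) (hk' : IsC11 k) (lam : ℝ)
    (θ : Coeff m) (β : Fin T → ℝ) {B : Matrix (Fin T) (Fin T) ℝ} (hB : B.PosSemidef) :
    learnObjective (fun _ => p) k x f lam θ β B
      = limitObjective (gram p k x) (dataFit x f β) lam θ B := by
  have h1 : mvSteinKernel (fun _ : Fin T => p) (sepKernel B k)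
      = fun y z => steinKernel p k y z • B :=
    funext fun y => funext fun z => mvSteinKernel_sepKernel p k B y z
  have hK : (opKernel fun y z => steinKernel p k y z • B).PosSemidef :=
    opKernel_posSemidef (fun s => gram_steinKernel_posSemidef hk hk' p fun a : s => (a : E d))
      (steinKernel_symm hk hk' p) hB
  have h2 := rkhsNorm_sq_eq hK x θ
  have h3 : quadTrace (gram p k x) B θ
      = ∑ a, ∑ b, θ a ⬝ᵥ ((steinKernel p k (x a) (x b) • B) *ᵥ θ b) := by
    rw [quadTrace_eq_sum]
    refine Finset.sum_comm.trans (Finset.sum_congr rfl fun a _ => Finset.sum_congr rfl fun b _ => ?_)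
    rw [trace_mul_smul_vecMulVec, Matrix.smul_mulVec, dotProduct_smul, smul_eq_mul, gram,
      Matrix.of_apply, steinKernel_symm hk hk']
  rw [learnObjective, limitObjective, h1, leastSquares_eq_dataFit p k x f hB.isHermitian, h3, ← h2]
  rfl

/-! ### Minimisers of least norm -/

/-- Projecting by `G† G` leaves the objective unchanged, so Pythagoras and least norm force the
projection to fix the coefficients. -/
theorem IsLeastNormMinimiser.pinv_mul_mul {G : Matrix (Idx m) (Idx m) ℝ} (hG : G.PosSemidef)
    {j : Coeff m → ℝ} {lam μ : ℝ} {q : Coeff m × Matrix (Fin T) (Fin T) ℝ}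
    (hq : IsLeastNormMinimiser (fun θ B => penalised G j lam μ θ B) q) :
    pinv G * (G * q.1) = q.1 := by
  have h1 : IsMinimiser (fun θ B => penalised G j lam μ θ B) (pinv G * (G * q.1), q.2) :=
    ⟨hq.1.1, fun θ B hB => by
      have := hq.1.2 θ B hB
      simp only at this ⊢
      rwa [penalised_congr hG (mul_pinv_mul_mul hG q.1)]⟩
  have h2 := hq.2 _ h1
  have h3 := frobSq_eq_add_pinv_mul_mul hG q.1
  have h4 : frobSq (q.1 - pinv G * (G * q.1)) = 0 :=
    le_antisymm (by simp only at h2; linarith) (frobSq_nonneg _)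
  exact (sub_eq_zero.1 (frobSq_eq_zero h4)).symm

theorem IsMinimiser.unique {G : Matrix (Idx m) (Idx m) ℝ} {j : Coeff m → ℝ} {lam μ : ℝ}
    (h : IsAdmissible G j lam) (hμ : 0 < μ) {q q' : Coeff m × Matrix (Fin T) (Fin T) ℝ}
    (hq : IsMinimiser (fun θ B => penalised G j lam μ θ B) q)
    (hq' : IsMinimiser (fun θ B => penalised G j lam μ θ B) q') :
    G * q.1 = G * q'.1 ∧ q.2 = q'.2 :=
  minimiser_penalised_unique h hμ hq.1 hq'.1 hq.2 hq'.2

theorem existsUnique_isLeastNormMinimiser {G : Matrix (Idx m) (Idx m) ℝ} {j : Coeff m → ℝ}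
    {lam μ : ℝ} (h : IsAdmissible G j lam) (hμ : 0 < μ) :
    ∃! q, IsLeastNormMinimiser (fun θ B => penalised G j lam μ θ B) q := by
  obtain ⟨θ, B, hB, hθ, hmin⟩ := exists_minimiser_penalised h hμ
  have hq : IsMinimiser (fun θ B => penalised G j lam μ θ B) (θ, B) := ⟨hB, hmin⟩
  refine ⟨(θ, B), ⟨hq, fun q' hq' => ?_⟩, fun q' hq' => ?_⟩
  · have h1 : G * θ = G * q'.1 := (hq.unique h hμ hq').1
    have h2 := frobSq_eq_add_pinv_mul_mul h.posSemidef q'.1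
    rw [← h1, hθ] at h2
    have := frobSq_nonneg (q'.1 - θ)
    simp only
    linarith
  · obtain ⟨h1, h2⟩ := hq'.1.unique h hμ hq
    have h3 := hq'.pinv_mul_mul h.posSemidef
    rw [h1] at h3
    exact Prod.ext (h3.symm.trans hθ) h2

theorem convexOn_penalised {G : Matrix (Idx m) (Idx m) ℝ} (hG : G.PosSemidef) {lam μ : ℝ}
    (hlam : 0 ≤ lam) (hμ : 0 ≤ μ) :
    ConvexOn ℝ {q : Coeff m × (Fin T → ℝ) × Matrix (Fin T) (Fin T) ℝ | q.2.2.PosDef}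
      (fun q => penalised G (dataFit x f q.2.1) lam μ q.1 q.2.2) := by
  have hconv : Convex ℝ {q : Coeff m × (Fin T → ℝ) × Matrix (Fin T) (Fin T) ℝ | q.2.2.PosDef} :=
    fun q hq q' hq' a b ha hb hab => convex_posDef hq hq' ha hb hab
  refine ⟨hconv, fun q hq q' hq' a b ha hb hab => ?_⟩
  have hD : (a • q.2.2 + b • q'.2.2).PosDef := hconv hq hq' ha hb hab
  have h1 := quadTrace_pinv_convex hG hq hq' ha hb hD q.1 q'.1
  have h2 := quadTrace_pinv_convex Matrix.PosSemidef.one hq hq' ha hb hD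
    (1 : Matrix (Fin T) (Fin T) ℝ) 1
  rw [← add_smul, hab, one_smul, quadTrace_one_one, quadTrace_one_one, quadTrace_one_one] at h2
  have h3 := dataFit_convex x f ha hb hab q.2.1 q'.2.1 (G * q.1) (G * q'.1)
  have h4 := frobSq_convex_comb hab q.2.2 q'.2.2
  have h5 := mul_nonneg (mul_nonneg ha hb) (frobSq_nonneg (q.2.2 - q'.2.2))
  have h6 := mul_le_mul_of_nonneg_left (add_le_add h1 (mul_le_mul_of_nonneg_left h2 hμ)) hlam
  simp only [penalised, Prod.fst_add, Prod.snd_add, Prod.smul_fst, Prod.smul_snd, Matrix.mul_add,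
    Matrix.mul_smul, smul_eq_mul] at h3 ⊢
  linarith

end Objectives

end VVCV

/-! ### The theorem for a common target -/

theorem theorem5 {d T : ℕ}
    -- the targets `Q_t` with densities `π_t`, all equal to the common target `P` with density `p`
    (Q : Fin T → Measure (E d)) (π : Fin T → E d → ℝ) (hπ : ∀ t, IsTarget (Q t) (π t))
    (P : Measure (E d)) (p : E d → ℝ) (hp : IsTarget P p) (hcommon : ∀ t, Q t = P)
    -- the scalar base kernel
    (k : E d → E d → ℝ) (hk : IsKernel k) (hk' : IsC11 k)
    -- the data
    (m : Fin T → ℕ) (hm : ∀ t, 0 < m t) (x : Idx m → E d) (f : Fin T → E d → ℝ) :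
    -- the Stein kernel is separable
    (∀ (B : Matrix (Fin T) (Fin T) ℝ) (y z : E d),
      mvSteinKernel π (sepKernel B k) y z = steinKernel p k y z • B) ∧
    -- joint convexity
    (∀ lam : ℝ, 0 ≤ lam → ∀ δ : ℝ, 0 < δ →
      ConvexOn ℝ {q : Coeff m × (Fin T → ℝ) × Matrix (Fin T) (Fin T) ℝ | q.2.2.PosDef}
        (fun q => regObjective π p k x f lam δ q.1 q.2.1 q.2.2)) ∧
    -- existence and uniqueness of the minimisers, for each `β`
    (∀ lam : ℝ, 0 < lam → ∀ β : Fin T → ℝ,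
      (∀ δ : ℝ, 0 < δ →
        (∃! q, IsLeastNormMinimiser (fun θ B => regObjective π p k x f lam δ θ β B) q) ∧
        (∀ q q', IsMinimiser (fun θ B => regObjective π p k x f lam δ θ β B) q →
          IsMinimiser (fun θ B => regObjective π p k x f lam δ θ β B) q' →
          gram p k x * q.1 = gram p k x * q'.1 ∧ q.2 = q'.2)) ∧
      -- convergence of the minimisers
      ∃ (θs : Coeff m) (Bs : Matrix (Fin T) (Fin T) ℝ),
        (∀ (δ : ℕ → ℝ), (∀ n, 0 < δ n) → Tendsto δ atTop (𝓝 0) →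
          ∀ q : ℕ → Coeff m × Matrix (Fin T) (Fin T) ℝ,
            (∀ n, IsMinimiser (fun θ B => regObjective π p k x f lam (δ n) θ β B) (q n)) →
            Tendsto (fun n => (q n).2) atTop (𝓝 Bs) ∧
            Tendsto (fun n => gram p k x * (q n).1) atTop (𝓝 (gram p k x * θs)) ∧
            (((gram p k x).PosDef ∨ ∀ n, IsLeastNormMinimiser
                (fun θ B => regObjective π p k x f lam (δ n) θ β B) (q n)) →
              Tendsto q atTop (𝓝 (θs, Bs)))) ∧
        -- the limit yields a minimiser of the objective which learns `B`
        IsSemidefMinimiser (fun θ B => learnObjective π k x f lam θ β B) (θs * pinv Bs, Bs) ∧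
        ∀ θ' : Coeff m, gram p k x * θ' = gram p k x * θs →
          IsSemidefMinimiser (fun θ B => learnObjective π k x f lam θ β B)
            (θ' * pinv Bs, Bs)) := by
  obtain rfl : π = fun _ => p := funext fun t => (hπ t).density_eq ((hcommon t).symm ▸ hp)
  have hG : (gram p k x).PosSemidef := gram_steinKernel_posSemidef hk hk' p x
  obtain ⟨w, hw, hreg⟩ := regObjective_eq_penalised p k x f hm
  simp only [hreg]
  refine ⟨mvSteinKernel_sepKernel p k, fun lam hlam δ _ =>
    convexOn_penalised hG hlam (mul_nonneg hw.le (sq_nonneg δ)), fun lam hlam β => ?_⟩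
  have hA := isAdmissible_dataFit hG hlam x f β
  refine ⟨fun δ hδ => ⟨existsUnique_isLeastNormMinimiser hA (mul_pos hw (pow_pos hδ 2)),
    fun q q' hq hq' => hq.unique hA (mul_pos hw (pow_pos hδ 2)) hq'⟩, ?_⟩
  obtain ⟨θ, B, hB, hθ, hθB, hmin, hlim⟩ := exists_limit_minimisers hA hw
  have hlearn : ∀ θ' : Coeff m, gram p k x * θ' = gram p k x * θ →
      IsSemidefMinimiser (fun θ B => learnObjective (fun _ => p) k x f lam θ β B)
        (θ' * pinv B, B) := fun θ' hθ' => by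
    refine ⟨hB, fun η C hC => ?_⟩
    simp only
    rw [learnObjective_eq_limitObjective hk hk' lam _ β hB,
      learnObjective_eq_limitObjective hk hk' lam _ β hC,
      limitObjective_mul_pinv hB (by rw [hθ', hθB]), penalised_congr hG hθ']
    exact hmin η C hC
  refine ⟨θ, B, fun δ hδ hδ0 q hq => ?_, hlearn θ rfl, hlearn⟩
  have h1 := hlim δ hδ hδ0 q (fun n => (hq n).1) (fun n => (hq n).2)
  have h2 : Tendsto (fun n => pinv (gram p k x) * (gram p k x * (q n).1)) atTop (𝓝 θ) :=
    (continuous_fst.tendsto _).comp h1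
  have hcont : Continuous fun M : Coeff m => gram p k x * M := by fun_prop
  refine ⟨(continuous_snd.tendsto _).comp h1, ?_, fun h => ?_⟩
  · refine ((hcont.tendsto θ).comp h2).congr fun n => ?_
    simp only [Function.comp_apply, mul_pinv_mul_mul hG]
  -- In both cases `G† G` fixes the minimisers, so convergence of the projections is convergence of
  -- the coefficients.
  · have h3 : ∀ n, pinv (gram p k x) * (gram p k x * (q n).1) = (q n).1 := fun n => by
      rcases h with h | h
      · rw [← Matrix.mul_assoc, pinv_mul_self_of_posDef h, Matrix.one_mul]
      · exact (h n).pinv_mul_mul hG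
    simpa only [h3] using h1
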